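/- **T-meshes.** A T-mesh $\mathcal T$ of $\mathbb R^2$ consists of a finite set $\mathcal T_2$ of non-degenerate axis-aligned open rectangles (faces), a finite set $\mathcal T_1$ of non-degenerate closed axis-aligned segments (edges), each contained in the boundary of some face, and the set $\mathcal T_0$ of end points of the edges (vertices), such that: the boundary $\partial\sigma$ of every face is a finite union of edges; for distinct faces $\sigma,\sigma'$, $\overline\sigma\cap\overline{\sigma'}=\partial\sigma\cap\partial\sigma'$ is a finite (possibly empty) union of edges and vertices; two distinct edges are disjoint or meet in exactly one point, which is a vertex; and the domain $\Omega=\bigcup_{\sigma\in\mathcal T_2}\overline\sigma$ is connected. The T-mesh is *simply connected* if $\Omega$ is simply connected and its interior $\mathring\Omega$ is connected. An edge is *interior* if it meets $\mathring\Omega$, a vertex is *interior* if it lies in $\mathring\Omega$; $\mathring{\mathcal T}_1$, $\mathring{\mathcal T}_0$ denote the sets of interior edges and vertices, and ${}^h\mathcal T_1$, ${}^v\mathcal T_1$ the sets of all horizontal and all vertical edges. **Splines.** Let $m,m'\ge 0$ be integers and let $\mathcal P=\mathcal P_{mm'}$ be the real span of the monomials $s^it^j$, $0\le i\le m$, $0\le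 j\le m'$. A *smoothness distribution* is a map $\mathbf r:\mathcal T_1\to\mathbb Z_{\ge -1}$ with $\mathbf r(\tau)=-1$ for every non-interior edge. The spline space $\mathcal R^{\mathbf r}=\mathcal R^{\mathbf r}_{mm'}(\mathcal T)$ is the space of functions $f:\bigcup_{\sigma\in\mathcal T_2}\sigma\to\mathbb R$ such that $f|_\sigma$ is given by an element of $\mathcal P$ for every face $\sigma$, and $f$ is $C^{\mathbf r(\tau)}$ across every interior edge $\tau$ (that is, if $\mathbf r(\tau)\ge 0$, then near the relative interior of $\tau$ the function $f$ is the restriction of a $C^{\mathbf r(\tau)}$ function; order $-1$ is no condition). **Complexes.** For an edge $\tau$ let $\ell_\tau$ be a non-zero linear polynomial vanishing on $\tau$, and let $\mathfrak J_\tau$ be the space of all elements of $\mathcal P$ divisible by $\ell_\tau^{\mathbf r(\tau)+1}$; for an interior vertex $\gamma$ let $\mathfrak J_\gamma=\sum_{\tau\ni\gamma}\mathfrak J_\tau$. Let $\mathcal I^{\mathbf r}$ be the complex $$0\to\bigoplus_{\tau\in\mathring{\mathcal T}_1}\mathfrak J_\tau\xrightarrow{\ \partial\ }\bigoplus_{\gamma\in\mathring{\mathcal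 T}_0}\mathfrak J_\gamma\to 0,$$ where $\partial$ is the cellular boundary map relative to $\partial\Omega$ (end points that are not interior vertices are dropped), so that $H_0(\mathcal I^{\mathbf r})=\operatorname{coker}\partial$. Let $\mathcal Q^{\mathbf r}$ be the complex $$\bigoplus_{\sigma\in\mathcal T_2}\mathcal P\to\bigoplus_{\tau\in\mathring{\mathcal T}_1}\mathcal P/\mathfrak J_\tau\to\bigoplus_{\gamma\in\mathring{\mathcal T}_0}\mathcal P/\mathfrak J_\gamma\to 0,$$ and let $\chi(\mathcal Q^{\mathbf r})=\dim\mathcal Q^{\mathbf r}_2-\dim\mathcal Q^{\mathbf r}_1+\dim\mathcal Q^{\mathbf r}_0$ be its Euler characteristic. For a vertex $\gamma$ put $$\mathbf r_h(\gamma)=\min_{\tau\ni\gamma,\ \tau\in{}^v\mathcal T_1}\mathbf r(\tau),\qquad \mathbf r_v(\gamma)=\min_{\tau\ni\gamma,\ \tau\in{}^h\mathcal T_1}\mathbf r(\tau),$$ with the convention $\min\emptyset=+\infty$. **Theorem.** Let $\mathcal T$ be a simply connected T-mesh, $m,m'\ge0$ integers and $\mathbf r$ a smoothness distribution on $\mathcal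 T$. Then $\mathcal R^{\mathbf r}$ and $H_0(\mathcal I^{\mathbf r})$ are finite-dimensional, $$\dim\mathcal R^{\mathbf r}=\chi(\mathcal Q^{\mathbf r})+\dim H_0(\mathcal I^{\mathbf r}),$$ and $$\begin{aligned}\chi(\mathcal Q^{\mathbf r})={}&\#\mathcal T_2\,(m+1)(m'+1)-(m+1)\sum_{\tau\in{}^h\mathcal T_1}\bigl(\min(\mathbf r(\tau),m')+1\bigr)-(m'+1)\sum_{\tau\in{}^v\mathcal T_1}\bigl(\min(\mathbf r(\tau),m)+1\bigr)\\&+\sum_{\gamma\in\mathcal T_0}\bigl(\min(\mathbf r_h(\gamma),m)+1\bigr)\bigl(\min(\mathbf r_v(\gamma),m')+1\bigr).\end{aligned}$$ **Corollary.** If moreover $\dim H_0(\mathcal I^{\mathbf r})=0$, then $\dim\mathcal R^{\mathbf r}=\chi(\mathcal Q^{\mathbf r})$, and the dimension is stable, i.e. does not depend on the geometric embedding, in the following sense: if $\mathcal T'$ is a simply connected T-mesh with a smoothness distribution $\mathbf r'$ for which $\dim H_0(\mathcal I^{\mathbf r'})=0$ too, and there are bijections between the faces, edges and vertices of $\mathcal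 T$ and $\mathcal T'$ that preserve incidences, the directions of edges (horizontal or vertical) and the orders of smoothness, then $\dim\mathcal R^{\mathbf r'}_{mm'}(\mathcal T')=\dim\mathcal R^{\mathbf r}_{mm'}(\mathcal T)$. -/

import Mathlib

/-- The two directions of an axis-aligned segment. -/
inductive Dir : Type
  | horizontal : Dir
  | vertical : Dir

/-- A non-degenerate axis-aligned rectangle. -/
structure Rect : Type where
  x₀ : ℝ
  x₁ : ℝ
  y₀ : ℝ
  y₁ : ℝ
  x_lt : x₀ < x₁
  y_lt : y₀ < y₁

/-- The open rectangle as a subset of the plane. -/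
def Rect.cell (σ : Rect) : Set (ℝ × ℝ) :=
  Set.Ioo σ.x₀ σ.x₁ ×ˢ Set.Ioo σ.y₀ σ.y₁

/-- A non-degenerate axis-aligned segment: `[a, b] × {c}` if it is horizontal and
`{c} × [a, b]` if it is vertical. -/
structure Seg : Type where
  dir : Dir
  c : ℝ
  a : ℝ
  b : ℝ
  lt : a < b

/-- The point of the line carrying the segment that has parameter `t`. -/
def Seg.point (τ : Seg) (t : ℝ) : ℝ × ℝ :=
  match τ.dir with
  | Dir.horizontal => (t, τ.c)
  | Dir.vertical => (τ.c, t)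

/-- The closed segment as a subset of the plane. -/
def Seg.carrier (τ : Seg) : Set (ℝ × ℝ) := τ.point '' Set.Icc τ.a τ.b

/-- The segment without its end points. -/
def Seg.relInterior (τ : Seg) : Set (ℝ × ℝ) := τ.point '' Set.Ioo τ.a τ.b

/-- The first end point. -/
def Seg.start (τ : Seg) : ℝ × ℝ := τ.point τ.a

/-- The second end point. -/
def Seg.finish (τ : Seg) : ℝ × ℝ := τ.point τ.b

theorem Seg.start_mem (τ : Seg) : τ.start ∈ τ.carrier :=
  ⟨τ.a, ⟨le_rfl, τ.lt.le⟩, rfl⟩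

theorem Seg.finish_mem (τ : Seg) : τ.finish ∈ τ.carrier :=
  ⟨τ.b, ⟨τ.lt.le, le_rfl⟩, rfl⟩

open Classical in
/-- The set of end points of a finite set of segments. -/
noncomputable def endPoints (E : Finset Seg) : Finset (ℝ × ℝ) :=
  E.image Seg.start ∪ E.image Seg.finish

/-- The union of the closed rectangles of a finite collection. -/
def closedUnion (F : Finset Rect) : Set (ℝ × ℝ) := ⋃ σ ∈ F, closure σ.cell

/-- A T-mesh: finitely many faces and edges, the vertices being the end points of the edges. -/
structure TMesh : Type where
  faces : Finset Rect
  edges : Finset Seg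
  /-- Every edge lies on the boundary of a face. -/
  edge_subset : ∀ τ ∈ edges, ∃ σ ∈ faces, τ.carrier ⊆ frontier σ.cell
  /-- The boundary of every face is a union of edges. -/
  frontier_eq : ∀ σ ∈ faces, ∃ E ⊆ edges, frontier σ.cell = ⋃ τ ∈ E, τ.carrier
  /-- Two closed faces meet only in their boundaries. -/
  face_inter : ∀ σ ∈ faces, ∀ σ' ∈ faces, σ ≠ σ' →
    closure σ.cell ∩ closure σ'.cell = frontier σ.cell ∩ frontier σ'.cell
  /-- The intersection of two closed faces is a (possibly empty) union of edges and vertices. -/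
  face_inter_eq : ∀ σ ∈ faces, ∀ σ' ∈ faces, σ ≠ σ' →
    ∃ E ⊆ edges, ∃ V ⊆ endPoints edges,
      closure σ.cell ∩ closure σ'.cell = (⋃ τ ∈ E, τ.carrier) ∪ (V : Set (ℝ × ℝ))
  /-- Two edges that meet do so in exactly one point, which is a vertex. -/
  edge_inter : ∀ τ ∈ edges, ∀ τ' ∈ edges, τ ≠ τ' → (τ.carrier ∩ τ'.carrier).Nonempty →
    ∃ γ ∈ endPoints edges, τ.carrier ∩ τ'.carrier = {γ}
  /-- The domain is connected. -/
  connected : IsConnected (closedUnion faces)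

namespace TMesh

/-- The domain `Ω` of the mesh, the union of its closed faces. -/
def domain (T : TMesh) : Set (ℝ × ℝ) := closedUnion T.faces

/-- The union of the open faces. -/
def openFaces (T : TMesh) : Set (ℝ × ℝ) := ⋃ σ ∈ T.faces, σ.cell

/-- The type of faces. -/
abbrev Face (T : TMesh) : Type := {σ : Rect // σ ∈ T.faces}

/-- The type of edges. -/
abbrev Edge (T : TMesh) : Type := {τ : Seg // τ ∈ T.edges}

/-- The type of vertices. -/
abbrev Vertex (T : TMesh) : Type := {γ : ℝ × ℝ // γ ∈ endPoints T.edges}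

/-- An edge is interior if it meets the interior of the domain. -/
def IsInteriorEdge (T : TMesh) (τ : T.Edge) : Prop :=
  (τ.1.carrier ∩ interior T.domain).Nonempty

/-- The type of interior edges. -/
abbrev InteriorEdge (T : TMesh) : Type := {τ : T.Edge // T.IsInteriorEdge τ}

/-- The type of vertices in the interior of the domain. -/
abbrev InteriorVertex (T : TMesh) : Type := {γ : T.Vertex // γ.1 ∈ interior T.domain}

noncomputable instance (T : TMesh) : Fintype T.InteriorEdge := Fintype.ofFinite _

noncomputable instance (T : TMesh) : Fintype T.InteriorVertex := Fintype.ofFinite _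

/-- A simply connected T-mesh: the domain is simply connected and its interior is connected. -/
structure IsSimplyConnected (T : TMesh) : Prop where
  domain_simplyConnected : SimplyConnectedSpace T.domain
  interior_connected : IsConnected (interior T.domain)

/-- A smoothness distribution: an integer `≥ -1` for every edge, which is `-1` on the edges that
are not interior. -/
structure Smoothness (T : TMesh) : Type where
  order : T.Edge → ℤ
  neg_one_le : ∀ τ, -1 ≤ order τ
  boundary_eq : ∀ τ, ¬ T.IsInteriorEdge τ → order τ = -1

end TMesh

/-- Real polynomials in the two variables `s = X 0` and `t = X 1`. -/
abbrev Poly₂ : Type := MvPolynomial (Fin 2) ℝ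

/-- The value of a polynomial at a point of the plane. -/
noncomputable def Poly₂.evalAt (p : Poly₂) (x : ℝ × ℝ) : ℝ :=
  MvPolynomial.eval ![x.1, x.2] p

/-- Polynomials of bi-degree at most `(m, m')`: the span of the monomials `s ^ i * t ^ j` with
`i ≤ m` and `j ≤ m'`. -/
noncomputable def biDegree (m m' : ℕ) : Submodule ℝ Poly₂ :=
  Submodule.span ℝ {p | ∃ i j : ℕ, i ≤ m ∧ j ≤ m' ∧
    p = MvPolynomial.X 0 ^ i * MvPolynomial.X 1 ^ j}

/-- A non-zero linear polynomial that vanishes on the segment. -/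
noncomputable def Seg.linearForm (τ : Seg) : Poly₂ :=
  match τ.dir with
  | Dir.horizontal => MvPolynomial.X 1 - MvPolynomial.C τ.c
  | Dir.vertical => MvPolynomial.X 0 - MvPolynomial.C τ.c

namespace TMesh

/-- A function on the union of the open faces is `C ^ k` smooth across an edge if, near the
relative interior of the edge, it is the restriction of a `C ^ k` function. -/
def SmoothAcross (T : TMesh) (k : ℕ) (τ : Seg) (f : T.openFaces → ℝ) : Prop :=
  ∃ (U : Set (ℝ × ℝ)) (g : ℝ × ℝ → ℝ), IsOpen U ∧ τ.relInterior ⊆ U ∧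
    ContDiffOn ℝ (k : WithTop ℕ∞) g U ∧ ∀ x : T.openFaces, (x : ℝ × ℝ) ∈ U → f x = g x

/-- The spline space: functions that are polynomial of bi-degree at most `(m, m')` on every open
face and smooth of the prescribed order across every interior edge (order `-1` is no condition). -/
noncomputable def splineSpace (T : TMesh) (m m' : ℕ) (r : T.Smoothness) :
    Submodule ℝ (T.openFaces → ℝ) where
  carrier := {f |
    (∀ σ ∈ T.faces, ∃ p ∈ biDegree m m', ∀ x : T.openFaces,
      (x : ℝ × ℝ) ∈ σ.cell → f x = p.evalAt x) ∧
    ∀ τ : T.Edge, T.IsInteriorEdge τ → 0 ≤ r.order τ →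
      T.SmoothAcross (r.order τ).toNat τ.1 f}
  add_mem' := by
    rintro f g ⟨hf, hf'⟩ ⟨hg, hg'⟩
    refine ⟨fun σ hσ => ?_, fun τ hτ h0 => ?_⟩
    · obtain ⟨p, hp, hpf⟩ := hf σ hσ
      obtain ⟨q, hq, hqg⟩ := hg σ hσ
      exact ⟨p + q, add_mem hp hq, fun x hx => by
        simp [Poly₂.evalAt, hpf x hx, hqg x hx]⟩
    · obtain ⟨U, F, hU, hτU, hF, hfF⟩ := hf' τ hτ h0
      obtain ⟨V, G, hV, hτV, hG, hgG⟩ := hg' τ hτ h0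
      exact ⟨U ∩ V, F + G, hU.inter hV, Set.subset_inter hτU hτV,
        (hF.mono Set.inter_subset_left).add (hG.mono Set.inter_subset_right),
        fun x hx => by simp [hfF x hx.1, hgG x hx.2]⟩
  zero_mem' :=
    ⟨fun _ _ => ⟨0, zero_mem _, fun x _ => by simp [Poly₂.evalAt]⟩,
      fun _ _ _ => ⟨Set.univ, 0, isOpen_univ, Set.subset_univ _, contDiffOn_const,
        fun _ _ => rfl⟩⟩
  smul_mem' := by
    rintro c f ⟨hf, hf'⟩
    refine ⟨fun σ hσ => ?_, fun τ hτ h0 => ?_⟩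
    · obtain ⟨p, hp, hpf⟩ := hf σ hσ
      exact ⟨c • p, Submodule.smul_mem _ c hp, fun x hx => by
        simp [Poly₂.evalAt, hpf x hx, MvPolynomial.smul_eval]⟩
    · obtain ⟨U, F, hU, hτU, hF, hfF⟩ := hf' τ hτ h0
      exact ⟨U, c • F, hU, hτU, hF.const_smul c, fun x hx => by simp [hfF x hx]⟩

/-- The space `J_τ` of the polynomials of bi-degree at most `(m, m')` that are multiples of
`ℓ_τ ^ (r(τ) + 1)`. -/
noncomputable def edgeIdeal {T : TMesh} (m m' : ℕ) (r : T.Smoothness) (τ : T.Edge) :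
    Submodule ℝ Poly₂ :=
  biDegree m m' ⊓
    (Ideal.span {τ.1.linearForm ^ (r.order τ + 1).toNat}).restrictScalars ℝ

/-- The space `J_γ`, the sum of the spaces `J_τ` over the edges `τ` that contain `γ`. -/
noncomputable def vertexIdeal {T : TMesh} (m m' : ℕ) (r : T.Smoothness) (γ : T.Vertex) :
    Submodule ℝ Poly₂ :=
  ⨆ (τ : T.Edge) (_ : γ.1 ∈ τ.1.carrier), edgeIdeal m m' r τ

/-- The coefficient of the vertex `γ` in the boundary of the edge `τ`. -/
noncomputable def incidence {T : TMesh} (τ : T.Edge) (γ : T.Vertex) : ℝ :=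
  open Classical in (if τ.1.finish = γ.1 then 1 else 0) - (if τ.1.start = γ.1 then 1 else 0)

/-- The cellular boundary map from chains of interior edges to chains of interior vertices (end
points on the boundary of the domain are dropped), with polynomial coefficients. -/
noncomputable def boundaryMap (T : TMesh) :
    (T.InteriorEdge → Poly₂) →ₗ[ℝ] (T.InteriorVertex → Poly₂) :=
  LinearMap.pi fun γ => ∑ τ : T.InteriorEdge, incidence τ.1 γ.1 • LinearMap.proj τ

/-- The term of degree one of the complex `I`: the direct sum of the `J_τ` over the interior
edges. -/
noncomputable def idealChain₁ (T : TMesh) (m m' : ℕ) (r : T.Smoothness) :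
    Submodule ℝ (T.InteriorEdge → Poly₂) :=
  Submodule.pi Set.univ fun τ => edgeIdeal m m' r τ.1

/-- The term of degree zero of the complex `I`: the direct sum of the `J_γ` over the interior
vertices. -/
noncomputable def idealChain₀ (T : TMesh) (m m' : ℕ) (r : T.Smoothness) :
    Submodule ℝ (T.InteriorVertex → Poly₂) :=
  Submodule.pi Set.univ fun γ => vertexIdeal m m' r γ.1

theorem boundaryMap_mem (T : TMesh) (m m' : ℕ) (r : T.Smoothness) :
    ∀ p ∈ T.idealChain₁ m m' r, T.boundaryMap p ∈ T.idealChain₀ m m' r := by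
  intro p hp γ _
  simp only [boundaryMap, LinearMap.pi_apply, LinearMap.sum_apply, LinearMap.smul_apply,
    LinearMap.proj_apply]
  refine Submodule.sum_mem _ fun τ _ => ?_
  by_cases h : γ.1.1 ∈ τ.1.1.carrier
  · refine Submodule.smul_mem _ _ ?_
    exact (le_iSup₂_of_le (f := fun (τ : T.Edge) (_ : γ.1.1 ∈ τ.1.carrier) =>
      edgeIdeal m m' r τ) τ.1 h le_rfl) (hp τ (Set.mem_univ _))
  · have h₁ : τ.1.1.finish ≠ γ.1.1 := fun e => h (e ▸ τ.1.1.finish_mem)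
    have h₂ : τ.1.1.start ≠ γ.1.1 := fun e => h (e ▸ τ.1.1.start_mem)
    simp [incidence, h₁, h₂]

/-- The differential of the complex `I`, from degree one to degree zero. -/
noncomputable def idealBoundary (T : TMesh) (m m' : ℕ) (r : T.Smoothness) :
    T.idealChain₁ m m' r →ₗ[ℝ] T.idealChain₀ m m' r :=
  T.boundaryMap.restrict (T.boundaryMap_mem m m' r)

/-- The homology of the complex `I` in degree zero. -/
abbrev IdealH₀ (T : TMesh) (m m' : ℕ) (r : T.Smoothness) : Type :=
  T.idealChain₀ m m' r ⧸ LinearMap.range (T.idealBoundary m m' r)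

/-- The term of degree two of the complex `Q`. -/
abbrev Q₂ (T : TMesh) (m m' : ℕ) : Type := T.Face → biDegree m m'

/-- The term of degree one of the complex `Q`. -/
abbrev Q₁ (T : TMesh) (m m' : ℕ) (r : T.Smoothness) : Type :=
  (τ : T.InteriorEdge) → biDegree m m' ⧸ (edgeIdeal m m' r τ.1).submoduleOf (biDegree m m')

/-- The term of degree zero of the complex `Q`. -/
abbrev Q₀ (T : TMesh) (m m' : ℕ) (r : T.Smoothness) : Type :=
  (γ : T.InteriorVertex) → biDegree m m' ⧸ (vertexIdeal m m' r γ.1).submoduleOf (biDegree m m')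

/-- The Euler characteristic of the complex `Q`, the alternating sum of the dimensions of its
terms. -/
noncomputable def eulerChar (T : TMesh) (m m' : ℕ) (r : T.Smoothness) : ℤ :=
  (Module.finrank ℝ (T.Q₂ m m') : ℤ) - Module.finrank ℝ (T.Q₁ m m' r)
    + Module.finrank ℝ (T.Q₀ m m' r)

open Classical in
/-- The least order of smoothness over the edges of direction `d` that contain `γ`; it is `⊤`
(that is, `+∞`) if there is no such edge. -/
noncomputable def minOrder {T : TMesh} (r : T.Smoothness) (d : Dir) (γ : T.Vertex) : WithTop ℤ :=
  (Finset.univ.filter fun τ : T.Edge => τ.1.dir = d ∧ γ.1 ∈ τ.1.carrier).inf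
    fun τ => (r.order τ : WithTop ℤ)

/-- `r_h(γ)`, the least order over the vertical edges at `γ`. -/
noncomputable def rh {T : TMesh} (r : T.Smoothness) (γ : T.Vertex) : WithTop ℤ :=
  minOrder r Dir.vertical γ

/-- `r_v(γ)`, the least order over the horizontal edges at `γ`. -/
noncomputable def rv {T : TMesh} (r : T.Smoothness) (γ : T.Vertex) : WithTop ℤ :=
  minOrder r Dir.horizontal γ

/-- `min x n` as an integer, for `x` possibly `+∞`. -/
def truncate (x : WithTop ℤ) (n : ℕ) : ℤ := min (x.untopD (n : ℤ)) (n : ℤ)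

open Classical in
/-- The combinatorial formula for the Euler characteristic; the sums run over all horizontal
edges, all vertical edges and all vertices of the mesh. -/
noncomputable def combinatorialFormula (T : TMesh) (m m' : ℕ) (r : T.Smoothness) : ℤ :=
  (T.faces.card : ℤ) * (m + 1) * (m' + 1)
    - (m + 1) * ∑ τ : T.Edge with τ.1.dir = Dir.horizontal, (min (r.order τ) (m' : ℤ) + 1)
    - (m' + 1) * ∑ τ : T.Edge with τ.1.dir = Dir.vertical, (min (r.order τ) (m : ℤ) + 1)
    + ∑ γ : T.Vertex, (truncate (rh r γ) m + 1) * (truncate (rv r γ) m' + 1)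

/-- A combinatorial equivalence of T-meshes with smoothness distributions: bijections of the
faces, edges and vertices that preserve incidences, directions of edges and orders of
smoothness. -/
structure CombinatorialEquiv {T T' : TMesh} (r : T.Smoothness) (r' : T'.Smoothness) : Type where
  face : T.Face ≃ T'.Face
  edge : T.Edge ≃ T'.Edge
  vertex : T.Vertex ≃ T'.Vertex
  edge_face_iff : ∀ τ σ, (edge τ).1.carrier ⊆ frontier (face σ).1.cell ↔
    τ.1.carrier ⊆ frontier σ.1.cell
  vertex_edge_iff : ∀ γ τ, (vertex γ).1 ∈ (edge τ).1.carrier ↔ γ.1 ∈ τ.1.carrier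
  dir_eq : ∀ τ, (edge τ).1.dir = τ.1.dir
  order_eq : ∀ τ, r'.order (edge τ) = r.order τ

end TMesh

/-!
The space of splines is the kernel of the first map of the complex `Q`, because a piecewise
polynomial function is of class `C ^ k` across an edge exactly if the two polynomials differ by a
multiple of `ℓ ^ (k + 1)` (`TMesh.smoothAcross_iff`). The complex `Q` is the quotient of the
complex of constant coefficients `⊕ P → ⊕ P → ⊕ P` over the faces, interior edges and interior
vertices by the complex `I`. If the constant complex is exact at the edges and at the vertices,
then counting dimensions (`Submodule.finrank_comap_add`) identifies `dim R - χ(Q)` with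
`dim H₀(I)`.

Exactness at the vertices (`TMesh.exists_edgeBoundary_eq`) is elementary: at every interior vertex
an edge starts that leads to the right or upwards, and on following such edges one ends on the
boundary of the domain, where end points are dropped.

Exactness at the edges (`TMesh.exists_primitive`) is where the domain has to be simply connected.
A relative cycle prescribes the jumps across the interior edges of a function of the faces that
has to be found. Such a function exists around every vertex `γ` (`TMesh.exists_local_primitive`):
around an interior vertex the jumps sum to zero, and around a boundary vertex a quadrant is
missing. For an integer cycle the local solutions `c_γ` are patched by a partition of unity `ρ_γ`
that is adapted to the edges: the functions `φ_σ = ∑ ρ_γ c_γ(σ)` on the closed faces differ by the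
prescribed jump along every interior edge and by integers at the vertices. Modulo one they define
a continuous map from the domain to the circle; it lifts to the real line
(`exists_int_of_closed_cover`), and the lift differs from `φ_σ` by an integer on every closed
face. These integers are, up to sign, the required function. Rational cycles follow by clearing
denominators, and polynomial ones by a basis over the rationals.

The combinatorial formula is a count of monomials: after moving a vertex to the origin, the spaces
`J_τ` and `J_γ` are spanned by monomials (`TMesh.map_vertexIdeal`). Edges and vertices on the
boundary contribute nothing, since every boundary vertex lies on an edge of order `-1`
(`TMesh.exists_boundary_edge`).
-/

/-! ### Coordinates of rectangles and segments -/

/-- The other direction. -/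
def Dir.flip : Dir → Dir
  | Dir.horizontal => Dir.vertical
  | Dir.vertical => Dir.horizontal

/-- The coordinate that varies along the direction `d`. -/
def Dir.coord (d : Dir) (p : ℝ × ℝ) : ℝ :=
  match d with
  | Dir.horizontal => p.1
  | Dir.vertical => p.2

/-- The lower bound of the rectangle in the coordinate `d`. -/
def Rect.lo (σ : Rect) : Dir → ℝ
  | Dir.horizontal => σ.x₀
  | Dir.vertical => σ.y₀

/-- The upper bound of the rectangle in the coordinate `d`. -/
def Rect.hi (σ : Rect) : Dir → ℝ
  | Dir.horizontal => σ.x₁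
  | Dir.vertical => σ.y₁

theorem Rect.lo_lt_hi (σ : Rect) (d : Dir) : σ.lo d < σ.hi d := by
  cases d
  · exact σ.x_lt
  · exact σ.y_lt

theorem Dir.ext_coord (d : Dir) {p q : ℝ × ℝ} (h1 : d.coord p = d.coord q)
    (h2 : d.flip.coord p = d.flip.coord q) : p = q := by
  cases d <;> simp only [Dir.coord, Dir.flip] at h1 h2 <;> ext <;> assumption

theorem Dir.continuous_coord (d : Dir) : Continuous d.coord := by
  cases d
  · exact continuous_fst
  · exact continuous_snd

/-- The point with coordinate `t` along `d` and coordinate `c` across `d`. -/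
def Dir.mk (d : Dir) (t c : ℝ) : ℝ × ℝ :=
  match d with
  | Dir.horizontal => (t, c)
  | Dir.vertical => (c, t)

@[simp] theorem Dir.coord_mk (d : Dir) (t c : ℝ) : d.coord (d.mk t c) = t := by cases d <;> rfl

@[simp] theorem Dir.flip_coord_mk (d : Dir) (t c : ℝ) : d.flip.coord (d.mk t c) = c := by
  cases d <;> rfl

theorem Dir.mk_ne {d : Dir} {t t' c : ℝ} (h : t < t') : d.mk t c ≠ d.mk t' c := fun e => by
  have := congrArg d.coord e
  simp only [Dir.coord_mk] at this
  exact h.ne this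

theorem Dir.continuous_mk (d : Dir) {α : Type*} [TopologicalSpace α] {f g : α → ℝ}
    (hf : Continuous f) (hg : Continuous g) : Continuous fun x => d.mk (f x) (g x) := by
  cases d
  · exact hf.prodMk hg
  · exact hg.prodMk hf

theorem Rect.closure_cell (σ : Rect) :
    closure σ.cell = Set.Icc σ.x₀ σ.x₁ ×ˢ Set.Icc σ.y₀ σ.y₁ := by
  rw [Rect.cell, closure_prod_eq, closure_Ioo σ.x_lt.ne, closure_Ioo σ.y_lt.ne]

theorem Rect.isOpen_cell (σ : Rect) : IsOpen σ.cell := isOpen_Ioo.prod isOpen_Ioo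

theorem Rect.mem_cell {σ : Rect} (d : Dir) {p : ℝ × ℝ} :
    p ∈ σ.cell ↔ (σ.lo d < d.coord p ∧ d.coord p < σ.hi d) ∧
      (σ.lo d.flip < d.flip.coord p ∧ d.flip.coord p < σ.hi d.flip) := by
  cases d <;> simp only [Rect.cell, Rect.lo, Rect.hi, Dir.coord, Dir.flip, Set.mem_prod,
    Set.mem_Ioo]
  tauto

theorem Rect.mem_closure {σ : Rect} (d : Dir) {p : ℝ × ℝ} :
    p ∈ closure σ.cell ↔ (σ.lo d ≤ d.coord p ∧ d.coord p ≤ σ.hi d) ∧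
      (σ.lo d.flip ≤ d.flip.coord p ∧ d.flip.coord p ≤ σ.hi d.flip) := by
  rw [Rect.closure_cell]
  cases d <;> simp only [Rect.lo, Rect.hi, Dir.coord, Dir.flip, Set.mem_prod, Set.mem_Icc]
  tauto

theorem Rect.frontier_cell (σ : Rect) : frontier σ.cell = closure σ.cell \ σ.cell :=
  σ.isOpen_cell.frontier_eq

theorem Rect.convex_closure (σ : Rect) : Convex ℝ (closure σ.cell) := by
  rw [Rect.closure_cell]
  exact (convex_Icc _ _).prod (convex_Icc _ _)

theorem Seg.point_eq (τ : Seg) (t : ℝ) : τ.point t = τ.dir.mk t τ.c := by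
  rcases τ with ⟨d, c, a, b, h⟩
  cases d <;> rfl

theorem Seg.mem_carrier {τ : Seg} {p : ℝ × ℝ} :
    p ∈ τ.carrier ↔ (τ.a ≤ τ.dir.coord p ∧ τ.dir.coord p ≤ τ.b) ∧ τ.dir.flip.coord p = τ.c := by
  constructor
  · rintro ⟨t, ht, rfl⟩
    rw [Seg.point_eq]
    simpa using ht
  · rintro ⟨h1, h2⟩
    exact ⟨_, h1, τ.dir.ext_coord (by simp [Seg.point_eq]) (by simp [Seg.point_eq, h2])⟩

theorem Seg.mem_relInterior {τ : Seg} {p : ℝ × ℝ} :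
    p ∈ τ.relInterior ↔
      (τ.a < τ.dir.coord p ∧ τ.dir.coord p < τ.b) ∧ τ.dir.flip.coord p = τ.c := by
  constructor
  · rintro ⟨t, ht, rfl⟩
    rw [Seg.point_eq]
    simpa using ht
  · rintro ⟨h1, h2⟩
    exact ⟨_, h1, τ.dir.ext_coord (by simp [Seg.point_eq]) (by simp [Seg.point_eq, h2])⟩

theorem Seg.relInterior_subset (τ : Seg) : τ.relInterior ⊆ τ.carrier :=
  Set.image_mono Set.Ioo_subset_Icc_self

theorem Seg.isCompact_carrier (τ : Seg) : IsCompact τ.carrier := by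
  refine isCompact_Icc.image ?_
  have : τ.point = fun t => τ.dir.mk t τ.c := funext τ.point_eq
  rw [this]
  exact τ.dir.continuous_mk continuous_id continuous_const

/-- The end point from which the segment extends in the positive (`true`) or negative (`false`)
direction. -/
def Seg.endpt (τ : Seg) (s : Bool) : ℝ × ℝ := if s then τ.start else τ.finish

theorem Seg.coord_start (τ : Seg) : τ.dir.coord τ.start = τ.a := by simp [Seg.start, Seg.point_eq]
theorem Seg.coord_finish (τ : Seg) : τ.dir.coord τ.finish = τ.b := by
  simp [Seg.finish, Seg.point_eq]
theorem Seg.flip_coord_start (τ : Seg) : τ.dir.flip.coord τ.start = τ.c := by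
  simp [Seg.start, Seg.point_eq]
theorem Seg.flip_coord_finish (τ : Seg) : τ.dir.flip.coord τ.finish = τ.c := by
  simp [Seg.finish, Seg.point_eq]

theorem Seg.endpt_mem (τ : Seg) (s : Bool) : τ.endpt s ∈ τ.carrier := by
  cases s
  · exact τ.finish_mem
  · exact τ.start_mem

theorem Seg.eq_or_mem_relInterior {τ : Seg} {p : ℝ × ℝ} (h : p ∈ τ.carrier) :
    p = τ.start ∨ p = τ.finish ∨ p ∈ τ.relInterior := by
  obtain ⟨⟨h1, h2⟩, h3⟩ := Seg.mem_carrier.1 h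
  rcases h1.eq_or_lt with h1 | h1
  · exact Or.inl (τ.dir.ext_coord (by rw [τ.coord_start, h1]) (by rw [τ.flip_coord_start, h3]))
  rcases h2.eq_or_lt with h2 | h2
  · exact Or.inr (Or.inl
      (τ.dir.ext_coord (by rw [τ.coord_finish, h2]) (by rw [τ.flip_coord_finish, h3])))
  · exact Or.inr (Or.inr (Seg.mem_relInterior.2 ⟨⟨h1, h2⟩, h3⟩))

theorem Seg.start_notMem_relInterior (τ : Seg) : τ.start ∉ τ.relInterior := fun h => by
  have := (Seg.mem_relInterior.1 h).1.1
  rw [τ.coord_start] at this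
  exact lt_irrefl _ this

theorem Seg.finish_notMem_relInterior (τ : Seg) : τ.finish ∉ τ.relInterior := fun h => by
  have := (Seg.mem_relInterior.1 h).1.2
  rw [τ.coord_finish] at this
  exact lt_irrefl _ this

/-- The interval `(l, u)` contains the points close to `x` on its right (`true`) or on its left
(`false`). -/
def InSide : Bool → ℝ → ℝ → ℝ → Prop
  | true, l, u, x => l ≤ x ∧ x < u
  | false, l, u, x => l < x ∧ x ≤ u

theorem InSide.le {s : Bool} {l u x : ℝ} (h : InSide s l u x) : l ≤ x ∧ x ≤ u := by
  cases s
  · exact ⟨h.1.le, h.2⟩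
  · exact ⟨h.1, h.2.le⟩

/-- Two intervals on the same side of a point overlap. -/
theorem InSide.exists_mem {s : Bool} {l u l' u' x : ℝ} (h : InSide s l u x)
    (h' : InSide s l' u' x) : ∃ y, (l < y ∧ y < u) ∧ (l' < y ∧ y < u') := by
  cases s
  · obtain ⟨y, hy1, hy2⟩ := exists_between (max_lt h.1 h'.1)
    exact ⟨y, ⟨(le_max_left _ _).trans_lt hy1, hy2.trans_le h.2⟩,
      ⟨(le_max_right _ _).trans_lt hy1, hy2.trans_le h'.2⟩⟩
  · obtain ⟨y, hy1, hy2⟩ := exists_between (lt_min h.2 h'.2)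
    exact ⟨y, ⟨h.1.trans_lt hy1, hy2.trans_le (min_le_left _ _)⟩,
      ⟨h'.1.trans_lt hy1, hy2.trans_le (min_le_right _ _)⟩⟩

/-- The rectangle contains the part close to `p` of the open quadrant at `p` on the side `s` in
the coordinate `d` and on the side `t` in the other one. -/
def Rect.Covers (σ : Rect) (d : Dir) (s t : Bool) (p : ℝ × ℝ) : Prop :=
  InSide s (σ.lo d) (σ.hi d) (d.coord p) ∧ InSide t (σ.lo d.flip) (σ.hi d.flip) (d.flip.coord p)

theorem Rect.covers_flip {σ : Rect} {d : Dir} {s t : Bool} {p : ℝ × ℝ} :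
    σ.Covers d.flip t s p ↔ σ.Covers d s t p := by
  cases d <;> exact and_comm

/-- The segment lies on the side of the rectangle, and the rectangle lies on the positive (`true`)
or negative (`false`) side of the segment. -/
def Rect.Borders (σ : Rect) (t : Bool) (τ : Seg) : Prop :=
  σ.lo τ.dir ≤ τ.a ∧ τ.b ≤ σ.hi τ.dir ∧ τ.c = if t then σ.lo τ.dir.flip else σ.hi τ.dir.flip

theorem Rect.Borders.inSide {σ : Rect} {t : Bool} {τ : Seg} (h : σ.Borders t τ) :
    InSide t (σ.lo τ.dir.flip) (σ.hi τ.dir.flip) τ.c := by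
  have := σ.lo_lt_hi τ.dir.flip
  cases t
  · exact ⟨by rw [h.2.2]; simpa, by rw [h.2.2]; simp⟩
  · exact ⟨by rw [h.2.2]; simp, by rw [h.2.2]; simpa⟩

theorem Rect.Borders.covers {σ : Rect} {t : Bool} {τ : Seg} (h : σ.Borders t τ) (s : Bool) :
    σ.Covers τ.dir s t (τ.endpt s) := by
  have h1 := h.1
  have h2 := h.2.1
  have h4 := τ.lt
  cases s
  · refine ⟨?_, ?_⟩
    · simp only [Seg.endpt, Bool.false_eq_true, if_false, τ.coord_finish]
      exact ⟨by linarith, by linarith⟩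
    · simp only [Seg.endpt, Bool.false_eq_true, if_false, τ.flip_coord_finish]
      exact h.inSide
  · refine ⟨?_, ?_⟩
    · simp only [Seg.endpt, if_true, τ.coord_start]
      exact ⟨by linarith, by linarith⟩
    · simp only [Seg.endpt, if_true, τ.flip_coord_start]
      exact h.inSide

theorem Rect.Borders.mem_closure {σ : Rect} {t : Bool} {τ : Seg} (h : σ.Borders t τ)
    {p : ℝ × ℝ} (hp : p ∈ τ.carrier) : p ∈ closure σ.cell := by
  obtain ⟨⟨h1, h2⟩, h3⟩ := Seg.mem_carrier.1 hp
  refine (Rect.mem_closure τ.dir).2 ⟨⟨h.1.trans h1, h2.trans h.2.1⟩, ?_⟩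
  rw [h3]
  exact h.inSide.le

namespace TMesh

variable {T : TMesh}

/-! ### Incidences of faces, edges and vertices -/

theorem mem_endPoints {E : Finset Seg} {p : ℝ × ℝ} :
    p ∈ endPoints E ↔ ∃ τ ∈ E, τ.start = p ∨ τ.finish = p := by
  classical
  simp only [endPoints, Finset.mem_union, Finset.mem_image]
  constructor
  · rintro (⟨τ, h, e⟩ | ⟨τ, h, e⟩)
    · exact ⟨τ, h, Or.inl e⟩
    · exact ⟨τ, h, Or.inr e⟩
  · rintro ⟨τ, h, e | e⟩
    · exact Or.inl ⟨τ, h, e⟩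
    · exact Or.inr ⟨τ, h, e⟩

theorem endpt_mem_endPoints {τ : Seg} (hτ : τ ∈ T.edges) (s : Bool) :
    τ.endpt s ∈ endPoints T.edges := by
  cases s
  · exact mem_endPoints.2 ⟨τ, hτ, Or.inr rfl⟩
  · exact mem_endPoints.2 ⟨τ, hτ, Or.inl rfl⟩

theorem frontier_of_mem_closure {σ σ' : Rect} (hσ : σ ∈ T.faces) (hσ' : σ' ∈ T.faces)
    (hne : σ ≠ σ') {p : ℝ × ℝ} (hp : p ∈ closure σ.cell) (hp' : p ∈ closure σ'.cell) :
    p ∈ frontier σ.cell := by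
  have : p ∈ closure σ.cell ∩ closure σ'.cell := ⟨hp, hp'⟩
  rw [T.face_inter σ hσ σ' hσ' hne] at this
  exact this.1

/-- An open face meets no other closed face. -/
theorem eq_of_mem_cell {σ σ' : Rect} (hσ : σ ∈ T.faces) (hσ' : σ' ∈ T.faces) {p : ℝ × ℝ}
    (hp : p ∈ σ.cell) (hp' : p ∈ closure σ'.cell) : σ = σ' := by
  by_contra hne
  have := frontier_of_mem_closure hσ hσ' hne (subset_closure hp) hp'
  rw [Rect.frontier_cell] at this
  exact this.2 hp

theorem notMem_cell_of_mem_edge {τ : Seg} (hτ : τ ∈ T.edges) {σ : Rect} (hσ : σ ∈ T.faces)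
    {p : ℝ × ℝ} (hp : p ∈ τ.carrier) : p ∉ σ.cell := by
  intro h
  obtain ⟨σ', hσ', hτσ'⟩ := T.edge_subset τ hτ
  have h1 := hτσ' hp
  rw [Rect.frontier_cell] at h1
  obtain rfl := eq_of_mem_cell hσ hσ' h h1.1
  exact h1.2 h

theorem edge_eq_of_two_mem {τ τ' : Seg} (hτ : τ ∈ T.edges) (hτ' : τ' ∈ T.edges)
    {p q : ℝ × ℝ} (hpq : p ≠ q) (hp : p ∈ τ.carrier) (hp' : p ∈ τ'.carrier)
    (hq : q ∈ τ.carrier) (hq' : q ∈ τ'.carrier) : τ = τ' := by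
  by_contra hne
  obtain ⟨γ, -, h⟩ := T.edge_inter τ hτ τ' hτ' hne ⟨p, hp, hp'⟩
  have h1 : p ∈ τ.carrier ∩ τ'.carrier := ⟨hp, hp'⟩
  have h2 : q ∈ τ.carrier ∩ τ'.carrier := ⟨hq, hq'⟩
  rw [h] at h1 h2
  exact hpq (h1.trans h2.symm)

/-- If a segment of positive length lies on the boundary of a face, then one of the edges on the
boundary contains two different points of it. -/
theorem exists_edge_of_segment_subset {σ : Rect} (hσ : σ ∈ T.faces) (d : Dir) {u v c : ℝ}
    (huv : u < v) (h : ∀ t, u < t → t < v → d.mk t c ∈ frontier σ.cell) :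
    ∃ τ ∈ T.edges, τ.carrier ⊆ frontier σ.cell ∧
      ∃ t t', (u < t ∧ t < v) ∧ (u < t' ∧ t' < v) ∧ t < t' ∧
        d.mk t c ∈ τ.carrier ∧ d.mk t' c ∈ τ.carrier := by
  obtain ⟨E, hE, hfr⟩ := T.frontier_eq σ hσ
  have h1 : Set.Ioo u v ⊆ ⋃ τ ∈ E, {t | t ∈ Set.Ioo u v ∧ d.mk t c ∈ τ.carrier} := by
    intro t ht
    have := h t ht.1 ht.2
    rw [hfr] at this
    simp only [Set.mem_iUnion, exists_prop] at this ⊢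
    obtain ⟨τ, hτ, h2⟩ := this
    exact ⟨τ, hτ, ht, h2⟩
  obtain ⟨τ, hτ, hinf⟩ : ∃ τ ∈ E, {t | t ∈ Set.Ioo u v ∧ d.mk t c ∈ τ.carrier}.Infinite := by
    by_contra! hfin
    exact (Set.Ioo_infinite huv) ((E.finite_toSet.biUnion fun τ hτ => hfin τ hτ).subset h1)
  obtain ⟨t, ht, t', ht', hlt⟩ := hinf.nontrivial.exists_lt
  refine ⟨τ, hE hτ, ?_, t, t', ht.1, ht'.1, hlt, ht.2, ht'.2⟩
  rw [hfr]
  exact Set.subset_biUnion_of_mem (u := fun τ : Seg => τ.carrier) hτ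

/-- If the closure of a face contains a portion of an edge, then the whole edge lies on one side of
the face. -/
theorem exists_borders {τ : Seg} (hτ : τ ∈ T.edges) {σ : Rect} (hσ : σ ∈ T.faces) {t : ℝ}
    (ht : σ.lo τ.dir < t ∧ t < σ.hi τ.dir) (ht' : τ.a < t ∧ t < τ.b)
    (hc : σ.lo τ.dir.flip ≤ τ.c ∧ τ.c ≤ σ.hi τ.dir.flip) : ∃ s, σ.Borders s τ := by
  have hne : ¬ (σ.lo τ.dir.flip < τ.c ∧ τ.c < σ.hi τ.dir.flip) := fun h =>
    notMem_cell_of_mem_edge hτ hσ (p := τ.dir.mk t τ.c)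
      (Seg.mem_carrier.2 (by simp [ht'.1.le, ht'.2.le]))
      ((Rect.mem_cell τ.dir).2 (by simp [ht, h]))
  have hc' : ∃ s : Bool, τ.c = if s then σ.lo τ.dir.flip else σ.hi τ.dir.flip := by
    rcases hc.1.eq_or_lt with h | h
    · exact ⟨true, by simp [h]⟩
    · rcases hc.2.eq_or_lt with h' | h'
      · exact ⟨false, by simp [h']⟩
      · exact absurd ⟨h, h'⟩ hne
  obtain ⟨s, hs⟩ := hc'
  refine ⟨s, ?_⟩
  have key : τ.carrier ⊆ frontier σ.cell := by
    obtain ⟨τ', hτ', hsub, u, u', hu, hu', hlt, hm, hm'⟩ := T.exists_edge_of_segment_subset hσ τ.dir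
      (u := max (σ.lo τ.dir) τ.a) (v := min (σ.hi τ.dir) τ.b) (c := τ.c)
      ((max_lt ht.1 ht'.1).trans (lt_min ht.2 ht'.2)) (by
        intro x hx hx'
        rw [max_lt_iff] at hx
        rw [lt_min_iff] at hx'
        rw [Rect.frontier_cell]
        refine ⟨(Rect.mem_closure τ.dir).2 ?_, fun h => hne ?_⟩
        · simp [hx.1.le, hx'.1.le, hc]
        · simpa using ((Rect.mem_cell τ.dir).1 h).2)
    rw [max_lt_iff, lt_min_iff] at hu hu'
    have hm1 : ∀ x, max (σ.lo τ.dir) τ.a < x → x < min (σ.hi τ.dir) τ.b →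
        τ.dir.mk x τ.c ∈ τ.carrier := by
      intro x hx hx'
      rw [max_lt_iff] at hx
      rw [lt_min_iff] at hx'
      exact Seg.mem_carrier.2 (by simp [hx.2.le, hx'.2.le])
    have := edge_eq_of_two_mem hτ hτ' (Dir.mk_ne hlt)
      (hm1 u (max_lt hu.1.1 hu.1.2) (lt_min hu.2.1 hu.2.2)) hm
      (hm1 u' (max_lt hu'.1.1 hu'.1.2) (lt_min hu'.2.1 hu'.2.2)) hm'
    rw [this]
    exact hsub
  have h1 := ((Rect.mem_closure τ.dir).1 (frontier_subset_closure (key τ.start_mem))).1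
  have h2 := ((Rect.mem_closure τ.dir).1 (frontier_subset_closure (key τ.finish_mem))).1
  rw [τ.coord_start] at h1
  rw [τ.coord_finish] at h2
  exact ⟨h1.1, h2.2, hs⟩

theorem exists_borders_of_subset {τ : Seg} (hτ : τ ∈ T.edges) {σ : Rect} (hσ : σ ∈ T.faces)
    (h : τ.carrier ⊆ frontier σ.cell) : ∃ s, σ.Borders s τ := by
  have h1 := (Rect.mem_closure τ.dir).1 (frontier_subset_closure (h τ.start_mem))
  have h2 := (Rect.mem_closure τ.dir).1 (frontier_subset_closure (h τ.finish_mem))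
  rw [τ.coord_start, τ.flip_coord_start] at h1
  rw [τ.coord_finish, τ.flip_coord_finish] at h2
  obtain ⟨t, ht, ht'⟩ := exists_between τ.lt
  exact exists_borders hτ hσ (t := t) ⟨by linarith, by linarith⟩ ⟨ht, ht'⟩ h1.2

/-- No vertex lies in the relative interior of an edge. -/
theorem vertex_notMem_relInterior {τ : Seg} (hτ : τ ∈ T.edges) {γ : ℝ × ℝ}
    (hγ : γ ∈ endPoints T.edges) : γ ∉ τ.relInterior := by
  intro h
  obtain ⟨τ', hτ', he⟩ := mem_endPoints.1 hγ
  obtain ⟨h1, h2⟩ := Seg.mem_relInterior.1 h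
  have hne : τ ≠ τ' := by
    rintro rfl
    rcases he with rfl | rfl
    · exact τ.start_notMem_relInterior h
    · exact τ.finish_notMem_relInterior h
  have hγ' : γ ∈ τ'.carrier := by
    rcases he with rfl | rfl
    · exact τ'.start_mem
    · exact τ'.finish_mem
  obtain ⟨h3, h4⟩ := Seg.mem_carrier.1 hγ'
  by_cases hd : τ'.dir = τ.dir
  · -- collinear segments would share a segment starting at `γ`
    rw [hd] at h3 h4
    obtain ⟨s, hs⟩ : ∃ s : Bool, InSide s τ'.a τ'.b (τ.dir.coord γ) := by
      rcases h3.1.eq_or_lt with h | h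
      · exact ⟨true, h3.1, by rw [← h]; exact τ'.lt⟩
      · exact ⟨false, h, h3.2⟩
    obtain ⟨y, hy, hy'⟩ := hs.exists_mem (l' := if s then τ.dir.coord γ else τ.a)
      (u' := if s then τ.b else τ.dir.coord γ) (by cases s <;> simp [InSide, h1])
    have hyab : τ.a ≤ y ∧ y ≤ τ.b ∧ y ≠ τ.dir.coord γ := by
      cases s <;> simp at hy'
      · exact ⟨hy'.1.le, (hy'.2.trans h1.2).le, hy'.2.ne⟩
      · exact ⟨(h1.1.trans hy'.1).le, hy'.2.le, hy'.1.ne'⟩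
    refine hne (edge_eq_of_two_mem hτ hτ' (q := τ.dir.mk y τ.c) ?_ (τ.relInterior_subset h) hγ'
      (Seg.mem_carrier.2 ?_) (Seg.mem_carrier.2 ?_))
    · intro e
      exact hyab.2.2 (by rw [e]; simp)
    · simp [hyab.1, hyab.2.1]
    · rw [hd, ← h4]
      simp [hy.1.le, hy.2.le, h2]
  · -- a face at the perpendicular edge has a side that covers only a part of `τ`
    have hd' : τ'.dir = τ.dir.flip := by
      revert hd
      cases τ'.dir <;> cases τ.dir <;> simp [Dir.flip]
    have hff : τ.dir.flip.flip = τ.dir := by cases τ.dir <;> rfl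
    obtain ⟨σ, hσ, hsub⟩ := T.edge_subset τ' hτ'
    obtain ⟨s, hs⟩ := exists_borders_of_subset hτ' hσ hsub
    have h5 := hs.inSide
    rw [Rect.Borders, hd', hff] at hs
    rw [hd', hff] at h5 h4
    rw [← h4] at h5
    rw [hd'] at h3
    obtain ⟨y, hy, hy'⟩ := h5.exists_mem (l' := τ.a) (u' := τ.b)
      (by cases s; exacts [⟨h1.1, h1.2.le⟩, ⟨h1.1.le, h1.2⟩])
    obtain ⟨s', hs'⟩ := exists_borders hτ hσ hy hy' (by
      rw [← h2]; exact ⟨hs.1.trans h3.1, h3.2.trans hs.2.1⟩)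
    have h6 := hs'.1
    have h7 := hs'.2.1
    have h8 := hs.2.2
    cases s <;> simp at h8 <;> linarith

/-- A vertex on an edge is one of its end points. -/
theorem eq_start_or_finish {τ : Seg} (hτ : τ ∈ T.edges) {γ : ℝ × ℝ}
    (hγ : γ ∈ endPoints T.edges) (h : γ ∈ τ.carrier) : τ.start = γ ∨ τ.finish = γ := by
  rcases Seg.eq_or_mem_relInterior h with h | h | h
  · exact Or.inl h.symm
  · exact Or.inr h.symm
  · exact absurd h (vertex_notMem_relInterior hτ hγ)

theorem edge_eq_of_mem_relInterior {τ τ' : Seg} (hτ : τ ∈ T.edges) (hτ' : τ' ∈ T.edges)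
    {p : ℝ × ℝ} (hp : p ∈ τ.relInterior) (hp' : p ∈ τ'.carrier) : τ' = τ := by
  by_contra hne
  have hp1 := τ.relInterior_subset hp
  obtain ⟨γ, hγ, h⟩ := T.edge_inter τ hτ τ' hτ' (Ne.symm hne) ⟨p, hp1, hp'⟩
  have : p ∈ τ.carrier ∩ τ'.carrier := ⟨hp1, hp'⟩
  rw [h] at this
  obtain rfl := this
  exact vertex_notMem_relInterior hτ hγ hp

theorem eq_of_covers {σ σ' : Rect} (hσ : σ ∈ T.faces) (hσ' : σ' ∈ T.faces) {d : Dir}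
    {s t : Bool} {p : ℝ × ℝ} (h : σ.Covers d s t p) (h' : σ'.Covers d s t p) : σ = σ' := by
  obtain ⟨x, hx, hx'⟩ := h.1.exists_mem h'.1
  obtain ⟨y, hy, hy'⟩ := h.2.exists_mem h'.2
  exact eq_of_mem_cell hσ hσ' (p := d.mk x y) ((Rect.mem_cell d).2 (by simp [hx, hy]))
    (subset_closure ((Rect.mem_cell d).2 (by simp [hx', hy'])))

/-- A face that covers a quadrant next to an edge borders that edge. -/
theorem borders_of_covers {τ : Seg} (hτ : τ ∈ T.edges) {σ : Rect} (hσ : σ ∈ T.faces)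
    {s t : Bool} (h : σ.Covers τ.dir s t (τ.endpt s)) : σ.Borders t τ := by
  have h1 : InSide s τ.a τ.b (τ.dir.coord (τ.endpt s)) := by
    cases s
    · simp only [Seg.endpt, Bool.false_eq_true, if_false, τ.coord_finish]
      exact ⟨τ.lt, le_rfl⟩
    · simp only [Seg.endpt, if_true, τ.coord_start]
      exact ⟨le_rfl, τ.lt⟩
  have h2 : τ.dir.flip.coord (τ.endpt s) = τ.c := by
    cases s
    · exact τ.flip_coord_finish
    · exact τ.flip_coord_start
  obtain ⟨y, hy, hy'⟩ := h.1.exists_mem h1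
  have h3 := h.2
  rw [h2] at h3
  obtain ⟨t', ht'⟩ := exists_borders hτ hσ hy hy' h3.le
  have h4 := ht'.2.2
  cases t <;> cases t' <;> try exact ht'
  · simp at h4
    exact absurd h3.1 (by rw [h4]; exact lt_irrefl _)
  · simp at h4
    exact absurd h3.2 (by rw [h4]; exact lt_irrefl _)

/-- If no edge leaves the vertex `γ` along a ray, then a face on one side of the ray is also on
its other side. -/
theorem exists_edge_or_covers {γ : ℝ × ℝ} (hγ : γ ∈ endPoints T.edges) {σ : Rect}
    (hσ : σ ∈ T.faces) {d : Dir} {s t : Bool} (h : σ.Covers d s t γ) :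
    (∃ τ ∈ T.edges, τ.dir = d ∧ τ.endpt s = γ) ∨ σ.Covers d s (!t) γ := by
  set x := d.coord γ with hx
  set y := d.flip.coord γ with hy
  by_cases hb : y = if t then σ.lo d.flip else σ.hi d.flip
  swap
  · right
    refine ⟨h.1, ?_⟩
    have h2 := h.2
    cases t
    · simp only [Bool.false_eq_true, if_false] at hb
      exact ⟨h2.1.le, lt_of_le_of_ne h2.2 hb⟩
    · simp only [if_true] at hb
      exact ⟨lt_of_le_of_ne h2.1 (Ne.symm hb), h2.2.le⟩
  left
  have hy' := h.2.le
  have hynot : ¬ (σ.lo d.flip < y ∧ y < σ.hi d.flip) := by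
    rw [hb]; cases t <;> simp
  -- the side of `σ` through `γ` is covered by edges
  set u := if s then x else σ.lo d with hu
  set v := if s then σ.hi d else x with hv
  have huv : u < v := by
    have := h.1
    cases s
    · exact this.1
    · exact this.2
  have hlo : σ.lo d ≤ u := by
    cases s
    · exact le_rfl
    · exact h.1.1
  have hhi : v ≤ σ.hi d := by
    cases s
    · exact h.1.2
    · exact le_rfl
  obtain ⟨E, hE, hfr⟩ := T.frontier_eq σ hσ
  have hside : ∀ r, u < r → r < v → d.mk r y ∈ frontier σ.cell := by
    intro r hr hr'
    rw [Rect.frontier_cell]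
    refine ⟨(Rect.mem_closure d).2 ?_, fun h => hynot ?_⟩
    · simp only [Dir.coord_mk, Dir.flip_coord_mk]
      exact ⟨⟨(hlo.trans_lt hr).le, (hr'.trans_le hhi).le⟩, hy'⟩
    · simpa using ((Rect.mem_cell d).1 h).2
  -- points of this side that tend to `γ`, infinitely many of them in one edge
  set w : ℝ := if s then v else u with hw
  have hwne : w ≠ x := by
    cases s
    · simp only [hw, hu, hv] at huv ⊢; simpa using huv.ne
    · simp only [hw, hu, hv] at huv ⊢; simpa using huv.ne'
  let q : ℕ → ℝ := fun n => x + (w - x) / (n + 2)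
  have hq : ∀ n, u < q n ∧ q n < v := by
    intro n
    have hn : (0 : ℝ) < n + 2 := by positivity
    have hn0 : (0 : ℝ) ≤ n := by positivity
    cases s
    · simp only [hw, hu, hv, q] at huv ⊢
      simp only [Bool.false_eq_true, if_false] at huv ⊢
      constructor
      · have : (x - σ.lo d) / (n + 2) < x - σ.lo d := by
          rw [div_lt_iff₀ hn]; nlinarith
        have e : (σ.lo d - x) / ((n : ℝ) + 2) = -((x - σ.lo d) / (n + 2)) := by ring
        rw [e]; linarith
      · have : (σ.lo d - x) / ((n : ℝ) + 2) < 0 := div_neg_of_neg_of_pos (by linarith) hn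
        linarith
    · simp only [hw, hu, hv, q] at huv ⊢
      simp only [if_true] at huv ⊢
      constructor
      · have : 0 < (σ.hi d - x) / ((n : ℝ) + 2) := div_pos (by linarith) hn
        linarith
      · have : (σ.hi d - x) / (n + 2) < σ.hi d - x := by
          rw [div_lt_iff₀ hn]; nlinarith
        linarith
  have hqtend : Filter.Tendsto q Filter.atTop (nhds x) := by
    have h1 : Filter.Tendsto (fun n : ℕ => (w - x) / ((n : ℝ) + 2)) Filter.atTop (nhds 0) :=
      Filter.Tendsto.div_atTop tendsto_const_nhds
        (Filter.tendsto_atTop_add_const_right _ _ tendsto_natCast_atTop_atTop)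
    simpa [q] using h1.const_add x
  have hex : ∀ n, ∃ τ ∈ E, d.mk (q n) y ∈ τ.carrier := by
    intro n
    have := hside (q n) (hq n).1 (hq n).2
    rw [hfr] at this
    simpa using this
  choose f hf hf' using hex
  obtain ⟨τ, hτinf⟩ : ∃ τ : {τ // τ ∈ E}, {n | f n = τ}.Infinite := by
    obtain ⟨τ, hτ⟩ := Finite.exists_infinite_fiber (fun n => (⟨f n, hf n⟩ : {τ // τ ∈ E}))
    refine ⟨τ, ?_⟩
    rw [Set.infinite_coe_iff] at hτ
    convert hτ using 1
    ext n
    simp [Subtype.ext_iff]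
  have hτE : τ.1 ∈ T.edges := hE τ.2
  have hfreq : ∃ᶠ n in Filter.atTop, d.mk (q n) y ∈ τ.1.carrier := by
    rw [Nat.frequently_atTop_iff_infinite]
    refine hτinf.mono ?_
    intro n hn
    have := hf' n
    rw [Set.mem_ofPred_eq] at hn
    rwa [hn] at this
  have hγeq : d.mk x y = γ := d.ext_coord (by simp [hx]) (by simp [hy])
  have hγmem : γ ∈ τ.1.carrier := by
    refine τ.1.isCompact_carrier.isClosed.mem_of_frequently_of_tendsto hfreq ?_
    rw [← hγeq]
    exact ((d.continuous_mk continuous_id continuous_const).tendsto x).comp hqtend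
  obtain ⟨n, hn⟩ := hfreq.exists
  have hqn : q n ≠ x := by
    intro e
    have : (w - x) / ((n : ℝ) + 2) = 0 := by simp only [q] at e; linarith
    rw [div_eq_zero_iff] at this
    rcases this with h | h
    · exact hwne (by linarith)
    · have : (0 : ℝ) < n + 2 := by positivity
      linarith
  have hd : τ.1.dir = d := by
    by_contra hne
    have hd' : τ.1.dir.flip = d := by
      revert hne
      cases τ.1.dir <;> cases d <;> simp [Dir.flip]
    have h1 := (Seg.mem_carrier.1 hn).2
    have h2 := (Seg.mem_carrier.1 hγmem).2
    rw [hd'] at h1 h2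
    rw [Dir.coord_mk] at h1
    exact hqn (h1.trans h2.symm)
  refine ⟨τ.1, hτE, hd, ?_⟩
  have h1 := (Seg.mem_carrier.1 hn).1
  rw [hd, Dir.coord_mk] at h1
  have hstart := τ.1.coord_start
  have hfinish := τ.1.coord_finish
  rw [hd] at hstart hfinish
  have h2 := hq n
  rcases eq_start_or_finish hτE hγ hγmem with e | e
  · cases s
    · exfalso
      rw [e] at hstart
      simp only [hv] at h2
      have h3 : q n < x := h2.2
      linarith
    · exact e
  · cases s
    · exact e
    · exfalso
      rw [e] at hfinish
      simp only [hu] at h2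
      have h3 : x < q n := h2.1
      linarith

/-! ### Interior points, edges and vertices -/

theorem mem_domain {p : ℝ × ℝ} : p ∈ T.domain ↔ ∃ σ ∈ T.faces, p ∈ closure σ.cell := by
  simp [domain, closedUnion]

/-- The unit step towards the positive (`true`) or negative (`false`) side. -/
def sgn (s : Bool) : ℝ := if s then 1 else -1

/-- An interval whose closure contains points arbitrarily close to `x` on one side of `x`
contains all points close to `x` on this side. -/
theorem inSide_of_frequently {s : Bool} {l u x : ℝ}
    (h : ∃ᶠ ε in nhdsWithin (0 : ℝ) (Set.Ioi 0), l ≤ x + ε * sgn s ∧ x + ε * sgn s ≤ u) :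
    InSide s l u x := by
  have ht : Filter.Tendsto (fun ε : ℝ => x + ε * sgn s) (nhdsWithin (0 : ℝ) (Set.Ioi 0))
      (nhds x) := by
    have : Continuous fun ε : ℝ => x + ε * sgn s := by fun_prop
    simpa using (this.tendsto 0).mono_left nhdsWithin_le_nhds
  have hcl : x ∈ Set.Icc l u := isClosed_Icc.mem_of_frequently_of_tendsto h ht
  obtain ⟨ε, hε, hpos⟩ := (h.and_eventually self_mem_nhdsWithin).exists
  have hpos : 0 < ε := hpos
  cases s
  · simp [sgn] at hε
    exact ⟨by linarith, hcl.2⟩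
  · simp [sgn] at hε
    exact ⟨hcl.1, by linarith⟩

/-- Every quadrant at an interior point of the domain is covered by a face. -/
theorem exists_covers {p : ℝ × ℝ} (hp : p ∈ interior T.domain) (d : Dir) (s t : Bool) :
    ∃ σ ∈ T.faces, σ.Covers d s t p := by
  set g : ℝ → ℝ × ℝ := fun ε => d.mk (d.coord p + ε * sgn s) (d.flip.coord p + ε * sgn t) with hg
  have hgc : Continuous g := d.continuous_mk (by fun_prop) (by fun_prop)
  have hg0 : g 0 = p := d.ext_coord (by simp [hg]) (by simp [hg])
  have hev : ∀ᶠ ε in nhdsWithin (0 : ℝ) (Set.Ioi 0), ∃ σ ∈ T.faces, g ε ∈ closure σ.cell := by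
    have : g ⁻¹' interior T.domain ∈ nhds (0 : ℝ) :=
      (isOpen_interior.preimage hgc).mem_nhds (by simpa [hg0] using hp)
    filter_upwards [nhdsWithin_le_nhds this] with ε hε
    exact mem_domain.1 (interior_subset hε)
  obtain ⟨σ, hσ, hfr⟩ : ∃ σ ∈ T.faces,
      ∃ᶠ ε in nhdsWithin (0 : ℝ) (Set.Ioi 0), g ε ∈ closure σ.cell := by
    by_contra! hcon
    have h1 : ∀ᶠ ε in nhdsWithin (0 : ℝ) (Set.Ioi 0), ∀ σ ∈ T.faces, g ε ∉ closure σ.cell := by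
      rw [Filter.eventually_all_finset]
      intro σ hσ
      exact hcon σ hσ
    obtain ⟨ε, ⟨σ, hσ, h2⟩, h3⟩ := (hev.and h1).exists
    exact h3 σ hσ h2
  refine ⟨σ, hσ, inSide_of_frequently (hfr.mono ?_), inSide_of_frequently (hfr.mono ?_)⟩
  · intro ε hε
    simpa [hg] using ((Rect.mem_closure d).1 hε).1
  · intro ε hε
    simpa [hg] using ((Rect.mem_closure d).1 hε).2

theorem inSide_eventually {s : Bool} {l u x : ℝ} (h : InSide s l u x) :
    ∀ᶠ y in nhds x, (if s then x ≤ y else y ≤ x) → l ≤ y ∧ y ≤ u := by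
  cases s
  · filter_upwards [lt_mem_nhds h.1] with y hy hyx
    exact ⟨hy.le, le_trans hyx h.2⟩
  · filter_upwards [gt_mem_nhds h.2] with y hy hyx
    exact ⟨le_trans h.1 hyx, hy.le⟩

/-- A point is interior to the domain if its four quadrants are covered by faces. -/
theorem mem_interior_of_covers {p : ℝ × ℝ} (d : Dir)
    (h : ∀ s t, ∃ σ ∈ T.faces, σ.Covers d s t p) : p ∈ interior T.domain := by
  rw [mem_interior_iff_mem_nhds]
  have h1 : ∀ s t : Bool, ∀ᶠ q in nhds p, (if s then d.coord p ≤ d.coord q else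
      d.coord q ≤ d.coord p) → (if t then d.flip.coord p ≤ d.flip.coord q else
      d.flip.coord q ≤ d.flip.coord p) → q ∈ T.domain := by
    intro s t
    obtain ⟨σ, hσ, hc⟩ := h s t
    filter_upwards [(d.continuous_coord.tendsto p).eventually (inSide_eventually hc.1),
      (d.flip.continuous_coord.tendsto p).eventually (inSide_eventually hc.2)] with q hq1 hq2 h3 h4
    exact mem_domain.2 ⟨σ, hσ, (Rect.mem_closure d).2 ⟨hq1 h3, hq2 h4⟩⟩
  filter_upwards [h1 true true, h1 true false, h1 false true, h1 false false] with q h1 h2 h3 h4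
  simp at h1 h2 h3 h4
  rcases le_total (d.coord p) (d.coord q) with h5 | h5 <;>
    rcases le_total (d.flip.coord p) (d.flip.coord q) with h6 | h6 <;> tauto

theorem exists_mem_relInterior {τ : T.Edge} (h : T.IsInteriorEdge τ) :
    ∃ p ∈ τ.1.relInterior, p ∈ interior T.domain := by
  obtain ⟨p, ⟨t, ht, rfl⟩, hp⟩ := h
  have hc : Continuous τ.1.point := by
    have : τ.1.point = fun t => τ.1.dir.mk t τ.1.c := funext τ.1.point_eq
    rw [this]
    exact τ.1.dir.continuous_mk continuous_id continuous_const
  rw [← closure_Ioo τ.1.lt.ne] at ht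
  obtain ⟨u, hu, hu'⟩ := mem_closure_iff.1 ht _ (isOpen_interior.preimage hc) hp
  exact ⟨_, ⟨u, hu', rfl⟩, hu⟩

/-- An interior edge has faces on both sides. -/
theorem exists_borders_side {τ : T.Edge} (h : T.IsInteriorEdge τ) (t : Bool) :
    ∃ σ : T.Face, σ.1.Borders t τ.1 := by
  obtain ⟨p, hp, hp'⟩ := exists_mem_relInterior h
  obtain ⟨h1, h2⟩ := Seg.mem_relInterior.1 hp
  obtain ⟨σ, hσ, hc⟩ := exists_covers hp' τ.1.dir true t
  obtain ⟨y, hy, hy'⟩ := hc.1.exists_mem (l' := τ.1.a) (u' := τ.1.b) ⟨h1.1.le, h1.2⟩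
  have h3 := hc.2
  rw [h2] at h3
  obtain ⟨t', ht'⟩ := exists_borders τ.2 hσ hy hy' h3.le
  refine ⟨⟨σ, hσ⟩, ?_⟩
  have h4 := ht'.2.2
  cases t <;> cases t' <;> try exact ht'
  · simp at h4
    exact absurd h3.1 (by rw [h4]; exact lt_irrefl _)
  · simp at h4
    exact absurd h3.2 (by rw [h4]; exact lt_irrefl _)

theorem eq_of_borders {τ : T.Edge} {σ σ' : T.Face} {t : Bool} (h : σ.1.Borders t τ.1)
    (h' : σ'.1.Borders t τ.1) : σ = σ' :=
  Subtype.ext (eq_of_covers σ.2 σ'.2 (h.covers true) (h'.covers true))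

/-- The face on the positive (`true`) or negative (`false`) side of an interior edge. -/
noncomputable def sideFace (τ : T.InteriorEdge) (t : Bool) : T.Face :=
  (exists_borders_side τ.2 t).choose

theorem sideFace_borders (τ : T.InteriorEdge) (t : Bool) : (sideFace τ t).1.Borders t τ.1.1 :=
  (exists_borders_side τ.2 t).choose_spec

theorem eq_sideFace {τ : T.InteriorEdge} {σ : T.Face} {t : Bool} (h : σ.1.Borders t τ.1.1) :
    σ = sideFace τ t :=
  eq_of_borders h (sideFace_borders τ t)

theorem sideFace_ne (τ : T.InteriorEdge) : sideFace τ true ≠ sideFace τ false := fun h => by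
  have h1 := (sideFace_borders τ true).2.2
  have h2 := (sideFace_borders τ false).2.2
  rw [h] at h1
  simp at h1 h2
  exact ((sideFace τ false).1.lo_lt_hi _).ne (h1.symm.trans h2)

/-- An edge with faces on both sides is interior. -/
theorem isInteriorEdge_of_borders {τ : T.Edge} {σ σ' : T.Face} (h : σ.1.Borders true τ.1)
    (h' : σ'.1.Borders false τ.1) : T.IsInteriorEdge τ := by
  obtain ⟨t, ht, ht'⟩ := exists_between τ.1.lt
  refine ⟨τ.1.dir.mk t τ.1.c, Seg.mem_carrier.2 (by simp [ht.le, ht'.le]),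
    mem_interior_of_covers τ.1.dir fun s t' => ?_⟩
  have h1 : ∀ s : Bool, ∀ l u, l ≤ τ.1.a → τ.1.b ≤ u → InSide s l u t := by
    intro s l u hl hu
    cases s
    · exact ⟨by linarith, by linarith⟩
    · exact ⟨by linarith, by linarith⟩
  cases t'
  · exact ⟨σ'.1, σ'.2, by simpa using h1 s _ _ h'.1 h'.2.1, by simpa using h'.inSide⟩
  · exact ⟨σ.1, σ.2, by simpa using h1 s _ _ h.1 h.2.1, by simpa using h.inSide⟩

/-- Two different faces whose closures meet at a point in the relative interior of an edge lie on
the two sides of this edge, which is interior. -/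
theorem exists_sideFace_of_mem_relInterior {σ σ' : T.Face} (hne : σ ≠ σ') {τ : T.Edge}
    {p : ℝ × ℝ} (hp : p ∈ τ.1.relInterior) (h : p ∈ closure σ.1.cell)
    (h' : p ∈ closure σ'.1.cell) : ∃ (hτ : T.IsInteriorEdge τ) (t : Bool),
      σ = sideFace ⟨τ, hτ⟩ t ∧ σ' = sideFace ⟨τ, hτ⟩ (!t) := by
  have key : ∀ σ : T.Face, p ∈ closure σ.1.cell → ∃ t, σ.1.Borders t τ.1 := by
    intro σ hσ
    obtain ⟨h1, h2⟩ := Seg.mem_relInterior.1 hp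
    obtain ⟨h3, h4⟩ := (Rect.mem_closure τ.1.dir).1 hσ
    rw [h2] at h4
    obtain ⟨y, hy, hy'⟩ : ∃ y, (σ.1.lo τ.1.dir < y ∧ y < σ.1.hi τ.1.dir) ∧
        (τ.1.a < y ∧ y < τ.1.b) := by
      obtain ⟨y, hy, hy'⟩ := exists_between (a₁ := max (σ.1.lo τ.1.dir) τ.1.a)
        (a₂ := min (σ.1.hi τ.1.dir) τ.1.b)
        (max_lt (lt_min (σ.1.lo_lt_hi _) (h3.1.trans_lt h1.2))
          (lt_min (h1.1.trans_le h3.2) τ.1.lt))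
      rw [max_lt_iff] at hy
      rw [lt_min_iff] at hy'
      exact ⟨y, ⟨hy.1, hy'.1⟩, hy.2, hy'.2⟩
    exact exists_borders τ.2 σ.2 hy hy' h4
  obtain ⟨t, ht⟩ := key σ h
  obtain ⟨t', ht'⟩ := key σ' h'
  obtain rfl : t' = !t := by
    cases t <;> cases t' <;> first | rfl | exact absurd (eq_of_borders ht ht') hne
  have hτ : T.IsInteriorEdge τ := by
    cases t
    · exact isInteriorEdge_of_borders ht' ht
    · exact isInteriorEdge_of_borders ht ht'
  exact ⟨hτ, t, eq_sideFace (τ := ⟨τ, hτ⟩) ht, eq_sideFace (τ := ⟨τ, hτ⟩) ht'⟩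

/-- The vertex at an end of an edge. -/
noncomputable def endVertex (τ : T.Edge) (s : Bool) : T.Vertex :=
  ⟨τ.1.endpt s, endpt_mem_endPoints τ.2 s⟩

theorem isInteriorEdge_of_mem {τ : T.Edge} {p : ℝ × ℝ} (hp : p ∈ interior T.domain)
    (h : p ∈ τ.1.carrier) : T.IsInteriorEdge τ := ⟨p, h, hp⟩

theorem vertex_notMem_cell (γ : T.Vertex) {σ : Rect} (hσ : σ ∈ T.faces) : γ.1 ∉ σ.cell := by
  obtain ⟨τ, hτ, h⟩ := mem_endPoints.1 γ.2
  refine notMem_cell_of_mem_edge hτ hσ ?_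
  rcases h with h | h
  · exact h ▸ τ.start_mem
  · exact h ▸ τ.finish_mem

/-- A vertex lies on an edge, hence on a face, which covers one of its quadrants. -/
theorem exists_covers_vertex (γ : T.Vertex) (d : Dir) :
    ∃ σ ∈ T.faces, ∃ s t, σ.Covers d s t γ.1 := by
  obtain ⟨τ, hτ, h⟩ := mem_endPoints.1 γ.2
  obtain ⟨σ, hσ, hsub⟩ := T.edge_subset τ hτ
  obtain ⟨t, ht⟩ := exists_borders_of_subset hτ hσ hsub
  obtain ⟨s, hs⟩ : ∃ s, τ.endpt s = γ.1 := by
    rcases h with h | h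
    exacts [⟨true, h⟩, ⟨false, h⟩]
  refine ⟨σ, hσ, ?_⟩
  have h1 := ht.covers s
  rw [hs] at h1
  by_cases hd : τ.dir = d
  · exact ⟨s, t, hd ▸ h1⟩
  · have hd' : τ.dir = d.flip := by
      revert hd
      cases τ.dir <;> cases d <;> simp [Dir.flip]
    rw [hd'] at h1
    exact ⟨t, s, Rect.covers_flip.1 h1⟩

/-- At every vertex on the boundary of the domain there is an edge that is not interior. -/
theorem exists_boundary_edge (γ : T.Vertex) (hγ : γ.1 ∉ interior T.domain) :
    ∃ τ : T.Edge, γ.1 ∈ τ.1.carrier ∧ ¬ T.IsInteriorEdge τ := by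
  by_contra! hcon
  -- otherwise coverage propagates from quadrant to quadrant
  have step : ∀ d s t, (∃ σ ∈ T.faces, σ.Covers d s t γ.1) →
      ∃ σ ∈ T.faces, σ.Covers d s (!t) γ.1 := by
    rintro d s t ⟨σ, hσ, hc⟩
    rcases exists_edge_or_covers γ.2 hσ hc with ⟨τ, hτ, rfl, he⟩ | h
    · have hint := hcon ⟨τ, hτ⟩ (he ▸ τ.endpt_mem s)
      have := (sideFace_borders ⟨⟨τ, hτ⟩, hint⟩ (!t)).covers s
      rw [he] at this
      exact ⟨_, (sideFace ⟨⟨τ, hτ⟩, hint⟩ (!t)).2, this⟩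
    · exact ⟨σ, hσ, h⟩
  have step' : ∀ d s t, (∃ σ ∈ T.faces, σ.Covers d s t γ.1) →
      ∃ σ ∈ T.faces, σ.Covers d (!s) t γ.1 := by
    rintro d s t ⟨σ, hσ, hc⟩
    obtain ⟨σ', hσ', hc'⟩ := step d.flip t s ⟨σ, hσ, Rect.covers_flip.2 hc⟩
    exact ⟨σ', hσ', Rect.covers_flip.1 hc'⟩
  refine hγ (mem_interior_of_covers Dir.horizontal ?_)
  obtain ⟨σ, hσ, s, t, hc⟩ := exists_covers_vertex γ Dir.horizontal
  have h1 := (⟨σ, hσ, hc⟩ : ∃ σ ∈ T.faces, σ.Covers Dir.horizontal s t γ.1)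
  intro s' t'
  have h2 : ∃ σ ∈ T.faces, σ.Covers Dir.horizontal s t' γ.1 := by
    by_cases h : t' = t
    · rw [h]; exact h1
    · rw [show t' = !t by cases t <;> cases t' <;> simp_all]
      exact step _ _ _ h1
  by_cases h : s' = s
  · rw [h]; exact h2
  · rw [show s' = !s by cases s <;> cases s' <;> simp_all]
    exact step' _ _ _ h2

/-- At every interior vertex some edge starts. -/
theorem exists_edge_start (γ : T.InteriorVertex) : ∃ τ : T.Edge, τ.1.start = γ.1.1 := by
  obtain ⟨σ, hσ, hc⟩ := exists_covers γ.2 Dir.horizontal true true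
  rcases exists_edge_or_covers γ.1.2 hσ hc with ⟨τ, hτ, -, he⟩ | h
  · exact ⟨⟨τ, hτ⟩, he⟩
  rcases exists_edge_or_covers γ.1.2 hσ (Rect.covers_flip.2 hc) with ⟨τ, hτ, -, he⟩ | h'
  · exact ⟨⟨τ, hτ⟩, he⟩
  exact absurd ((Rect.mem_cell Dir.horizontal).2 ⟨⟨h'.2.1, hc.1.2⟩, h.2.1, hc.2.2⟩)
    (vertex_notMem_cell γ.1 hσ)

/-! ### The relative cellular chain complex -/

open Classical in
/-- The coefficient of the vertex `γ` in the boundary of the edge `τ`, as an integer. -/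
noncomputable def intIncidence (τ : T.Edge) (γ : T.Vertex) : ℤ :=
  (if τ.1.finish = γ.1 then 1 else 0) - (if τ.1.start = γ.1 then 1 else 0)

theorem incidence_eq (τ : T.Edge) (γ : T.Vertex) : incidence τ γ = intIncidence τ γ := by
  unfold incidence intIncidence
  push_cast
  rfl

/-- The orientation of the face on the positive side of an edge relative to this edge, the edge
being directed from its first to its second end point: the face above a horizontal edge is on the
left and the face to the right of a vertical edge is on the right. -/
def _root_.Dir.sign : Dir → ℤ
  | Dir.horizontal => 1
  | Dir.vertical => -1

theorem _root_.Dir.sign_mul_self (d : Dir) : Dir.sign d * Dir.sign d = 1 := by cases d <;> rfl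

section Chains

variable {V : Type*} [AddCommGroup V]

/-- The jump of a function of the faces across an interior edge. -/
noncomputable def jump (u : T.Face → V) (τ : T.InteriorEdge) : V :=
  u (sideFace τ true) - u (sideFace τ false)

/-- The boundary of a chain of interior edges, relative to the boundary of the domain. -/
noncomputable def edgeBoundary (z : T.InteriorEdge → V) (γ : T.InteriorVertex) : V :=
  ∑ τ, intIncidence τ.1 γ.1 • z τ

open Classical in
/-- The value of a chain on the interior edge of direction `d` that leaves the vertex `γ` to the
side `s`, zero if there is no such edge. -/
noncomputable def raySum (z : T.InteriorEdge → V) (d : Dir) (s : Bool) (γ : T.Vertex) : V :=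
  ∑ τ, if τ.1.1.dir = d ∧ τ.1.1.endpt s = γ.1 then z τ else 0

/-- At most one edge of a given direction leaves a point to a given side. -/
theorem edge_eq_of_endpt {τ τ' : T.Edge} {s : Bool} (hd : τ.1.dir = τ'.1.dir)
    (he : τ.1.endpt s = τ'.1.endpt s) : τ = τ' := by
  refine Subtype.ext ?_
  have hc : τ.1.c = τ'.1.c := by
    have h1 := congrArg τ.1.dir.flip.coord he
    cases s
    · simp only [Seg.endpt, Bool.false_eq_true, if_false, Seg.flip_coord_finish] at h1
      rw [h1, hd, Seg.flip_coord_finish]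
    · simp only [Seg.endpt, if_true, Seg.flip_coord_start] at h1
      rw [h1, hd, Seg.flip_coord_start]
  have h1 := congrArg τ.1.dir.coord he
  have h2 : ∀ τ : Seg, InSide s τ.a τ.b (τ.dir.coord (τ.endpt s)) := by
    intro τ
    cases s
    · simp only [Seg.endpt, Bool.false_eq_true, if_false, τ.coord_finish]
      exact ⟨τ.lt, le_rfl⟩
    · simp only [Seg.endpt, if_true, τ.coord_start]
      exact ⟨le_rfl, τ.lt⟩
  have h3 := h2 τ'.1
  rw [← hd, ← h1] at h3
  obtain ⟨y, hy, hy'⟩ := (h2 τ.1).exists_mem h3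
  have hne : τ.1.endpt s ≠ τ.1.dir.mk y τ.1.c := by
    intro e
    have := congrArg τ.1.dir.coord e
    simp only [Dir.coord_mk] at this
    cases s
    · simp only [Seg.endpt, Bool.false_eq_true, if_false, Seg.coord_finish] at this
      linarith
    · simp only [Seg.endpt, if_true, Seg.coord_start] at this
      linarith
  refine edge_eq_of_two_mem τ.2 τ'.2 hne (τ.1.endpt_mem s) (he ▸ τ'.1.endpt_mem s)
    (Seg.mem_carrier.2 (by simp [hy.1.le, hy.2.le])) (Seg.mem_carrier.2 ?_)
  rw [← hd, hc]
  simp [hy'.1.le, hy'.2.le]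

theorem raySum_eq (z : T.InteriorEdge → V) {s : Bool} (τ : T.InteriorEdge) {γ : T.Vertex}
    (h : τ.1.1.endpt s = γ.1) : raySum z τ.1.1.dir s γ = z τ := by
  unfold raySum
  rw [Finset.sum_eq_single τ]
  · simp [h]
  · intro τ' _ hne
    rw [if_neg]
    rintro ⟨h1, h2⟩
    exact hne (Subtype.ext (edge_eq_of_endpt h1 (h2.trans h.symm)))
  · simp

theorem raySum_eq_zero (z : T.InteriorEdge → V) {d : Dir} {s : Bool} {γ : T.Vertex}
    (h : ∀ τ : T.InteriorEdge, τ.1.1.dir = d → τ.1.1.endpt s ≠ γ.1) : raySum z d s γ = 0 := by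
  unfold raySum
  refine Finset.sum_eq_zero fun τ _ => ?_
  rw [if_neg]
  rintro ⟨h1, h2⟩
  exact h τ h1 h2

/-- A chain of interior edges is a relative cycle at a vertex exactly if the corresponding jumps
sum to zero around this vertex. -/
theorem edgeBoundary_sign_smul (z : T.InteriorEdge → V) (γ : T.InteriorVertex) :
    edgeBoundary (fun τ => Dir.sign τ.1.1.dir • z τ) γ =
      (raySum z Dir.horizontal false γ.1 - raySum z Dir.horizontal true γ.1) -
      (raySum z Dir.vertical false γ.1 - raySum z Dir.vertical true γ.1) := by
  unfold edgeBoundary raySum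
  simp only [← Finset.sum_sub_distrib]
  refine Finset.sum_congr rfl fun τ _ => ?_
  unfold intIncidence
  cases hd : τ.1.1.dir <;> by_cases h1 : τ.1.1.finish = γ.1.1 <;>
    by_cases h2 : τ.1.1.start = γ.1.1 <;> simp [Seg.endpt, h1, h2, Dir.sign]

/-- The jumps of a function of the faces across the rays at an interior vertex are the differences
of its values on the adjacent quadrants, whether or not there is an edge along the ray. -/
theorem raySum_jump (u : T.Face → V) (γ : T.InteriorVertex) (d : Dir) (q : Bool → Bool → T.Face)
    (hq : ∀ s t, (q s t).1.Covers d s t γ.1.1) (s : Bool) :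
    raySum (jump u) d s γ.1 = u (q s true) - u (q s false) := by
  by_cases h : ∃ τ : T.Edge, τ.1.dir = d ∧ τ.1.endpt s = γ.1.1
  · obtain ⟨τ, rfl, he⟩ := h
    have hint : T.IsInteriorEdge τ := isInteriorEdge_of_mem γ.2 (he ▸ τ.1.endpt_mem s)
    rw [raySum_eq _ ⟨τ, hint⟩ he, jump]
    have h1 : ∀ t, q s t = sideFace ⟨τ, hint⟩ t := fun t =>
      eq_sideFace (τ := ⟨τ, hint⟩) (borders_of_covers τ.2 (q s t).2 (he ▸ hq s t))
    rw [h1, h1]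
  · rw [raySum_eq_zero _ fun τ h1 h2 => h ⟨τ.1, h1, h2⟩]
    rcases exists_edge_or_covers γ.1.2 (q s true).2 (hq s true) with ⟨τ, hτ, h1, h2⟩ | h1
    · exact absurd ⟨⟨τ, hτ⟩, h1, h2⟩ h
    · rw [show q s true = q s false from
        Subtype.ext (eq_of_covers (q s true).2 (q s false).2 h1 (hq s false)), sub_self]

/-- The relative boundary of the boundary of a chain of faces vanishes. -/
theorem edgeBoundary_jump (u : T.Face → V) (γ : T.InteriorVertex) :
    edgeBoundary (fun τ => Dir.sign τ.1.1.dir • jump u τ) γ = 0 := by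
  have h : ∀ s t, ∃ σ : T.Face, σ.1.Covers Dir.horizontal s t γ.1.1 := fun s t => by
    obtain ⟨σ, hσ, hc⟩ := exists_covers γ.2 Dir.horizontal s t
    exact ⟨⟨σ, hσ⟩, hc⟩
  choose q hq using h
  rw [edgeBoundary_sign_smul, raySum_jump u γ _ q hq, raySum_jump u γ _ q hq,
    raySum_jump u γ Dir.vertical (fun s t => q t s)
      (fun s t => Rect.covers_flip (d := Dir.horizontal).2 (hq t s)),
    raySum_jump u γ Dir.vertical (fun s t => q t s)
      (fun s t => Rect.covers_flip (d := Dir.horizontal).2 (hq t s))]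
  abel

/-- Values on the four quadrants with prescribed differences across the four rays, as far as both
adjacent quadrants satisfy `P`. The compatibility condition is needed only if all quadrants do. -/
theorem exists_quadrant_values (a b : Bool → V) (P : Bool → Bool → Prop)
    (h : (∀ s t, P s t) → a true - a false = b true - b false) :
    ∃ C : Bool → Bool → V, (∀ s, P s true → P s false → C s true - C s false = a s) ∧
      ∀ t, P true t → P false t → C true t - C false t = b t := by
  have main : ∀ a : Bool → V, a true - a false = b true - b false →
      ∃ C : Bool → Bool → V, (∀ s, C s true - C s false = a s) ∧
        ∀ t, C true t - C false t = b t := by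
    intro a h
    refine ⟨fun s t => (if s then b false else 0) + if t then a s else 0, fun s => ?_, fun t => ?_⟩
    · simp
    · cases t
      · simp
      · simp only [if_true, Bool.false_eq_true, if_false, zero_add]
        rw [add_sub_assoc, h]
        abel
  by_cases hP : ∀ s t, P s t
  · obtain ⟨C, h1, h2⟩ := main a (h hP)
    exact ⟨C, fun s _ _ => h1 s, fun t _ _ => h2 t⟩
  · push Not at hP
    obtain ⟨s₀, t₀, h0⟩ := hP
    -- the difference across the ray next to the missing quadrant may be changed
    obtain ⟨C, h1, h2⟩ := main (fun s => if s = s₀ then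
      (if s then a false + (b true - b false) else a true - (b true - b false)) else a s)
      (by cases s₀ <;> simp)
    refine ⟨C, fun s hs hs' => ?_, fun t _ _ => h2 t⟩
    rw [h1, if_neg]
    rintro rfl
    cases t₀ <;> contradiction

theorem _root_.Bool.eq_or_eq_of_ne {s t : Bool} (h : s ≠ t) (r : Bool) : r = s ∨ r = t := by
  revert h
  cases r <;> cases s <;> cases t <;> simp

/-- Around every vertex a relative cycle is the boundary of a chain of faces. -/
theorem exists_local_primitive (z : T.InteriorEdge → V)
    (hz : ∀ γ, edgeBoundary (fun τ => Dir.sign τ.1.1.dir • z τ) γ = 0) (γ : T.Vertex) :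
    ∃ c : T.Face → V, ∀ τ : T.InteriorEdge, γ.1 ∈ τ.1.1.carrier → jump c τ = z τ := by
  set P : Bool → Bool → Prop := fun s t => ∃ σ : T.Face, σ.1.Covers Dir.horizontal s t γ.1 with hP
  obtain ⟨C, hC, hC'⟩ := exists_quadrant_values (raySum z Dir.horizontal · γ)
    (raySum z Dir.vertical · γ) P (by
      intro hall
      have hint : γ.1 ∈ interior T.domain := mem_interior_of_covers Dir.horizontal fun s t => by
        obtain ⟨σ, hσ⟩ := hall s t
        exact ⟨σ.1, σ.2, hσ⟩
      have h1 := hz ⟨γ, hint⟩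
      rw [edgeBoundary_sign_smul, sub_eq_zero] at h1
      rw [← neg_sub, h1, neg_sub])
  -- no interior edge leaves `γ` inside a face
  have hzero : ∀ (σ : T.Face) d s, (∀ t, σ.1.Covers d s t γ.1) → raySum z d s γ = 0 := by
    intro σ d s h
    refine raySum_eq_zero _ fun τ hd he => ?_
    subst hd
    have h1 := fun t => eq_sideFace (borders_of_covers τ.1.2 σ.2 (t := t) (s := s) (he ▸ h t))
    exact sideFace_ne τ ((h1 true).symm.trans (h1 false))
  have hwd : ∀ (σ : T.Face) s t s' t', σ.1.Covers Dir.horizontal s t γ.1 →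
      σ.1.Covers Dir.horizontal s' t' γ.1 → C s t = C s' t' := by
    intro σ s t s' t' h h'
    have h1 : C s t = C s t' := by
      by_cases hs : ∀ t, σ.1.Covers Dir.horizontal s t γ.1
      · have := hC s ⟨σ, hs true⟩ ⟨σ, hs false⟩
        rw [hzero σ _ _ hs, sub_eq_zero] at this
        cases t <;> cases t' <;> simp [this]
      · have : t = t' := by
          by_contra hne
          refine hs fun r => ?_
          have : r = t ∨ r = t' := Bool.eq_or_eq_of_ne hne r
          rcases this with rfl | rfl
          · exact h
          · exact ⟨h.1, h'.2⟩
        rw [this]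
    have h2 : C s t' = C s' t' := by
      by_cases hs : ∀ s, σ.1.Covers Dir.horizontal s t' γ.1
      · have := hC' t' ⟨σ, hs true⟩ ⟨σ, hs false⟩
        rw [hzero σ Dir.vertical _ fun s => Rect.covers_flip (d := Dir.horizontal).2 (hs s),
          sub_eq_zero] at this
        cases s <;> cases s' <;> simp [this]
      · have : s = s' := by
          by_contra hne
          refine hs fun r => ?_
          have : r = s ∨ r = s' := Bool.eq_or_eq_of_ne hne r
          rcases this with rfl | rfl
          · exact ⟨h.1, h'.2⟩
          · exact h'
        rw [this]
    exact h1.trans h2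
  classical
  obtain ⟨c, hval⟩ : ∃ c : T.Face → V, ∀ σ s t, σ.1.Covers Dir.horizontal s t γ.1 →
      c σ = C s t := by
    refine ⟨fun σ => if h : ∃ s t, σ.1.Covers Dir.horizontal s t γ.1 then
      C h.choose h.choose_spec.choose else 0, fun σ s t h => ?_⟩
    have h1 : ∃ s t, σ.1.Covers Dir.horizontal s t γ.1 := ⟨s, t, h⟩
    simp only [dif_pos h1]
    exact hwd σ _ _ _ _ h1.choose_spec.choose_spec h
  refine ⟨c, fun τ hτ => ?_⟩
  obtain ⟨s, hs⟩ : ∃ s, τ.1.1.endpt s = γ.1 := by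
    rcases eq_start_or_finish τ.1.2 γ.2 hτ with h | h
    exacts [⟨true, h⟩, ⟨false, h⟩]
  have hb := fun t => (sideFace_borders τ t).covers s
  simp only [hs] at hb
  have hray := raySum_eq z τ hs
  unfold jump
  cases hd : τ.1.1.dir <;> rw [hd] at hb hray
  · rw [hval _ s true (hb true), hval _ s false (hb false), hC s ⟨_, hb true⟩ ⟨_, hb false⟩]
    exact hray
  · have hb' := fun t => Rect.covers_flip (d := Dir.horizontal).1 (hb t)
    rw [hval _ true s (hb' true), hval _ false s (hb' false),
      hC' s ⟨_, hb' true⟩ ⟨_, hb' false⟩]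
    exact hray

end Chains

/-- Every interior vertex is a relative boundary: starting from it one can walk along edges to the
right and upwards until the boundary of the domain is reached. -/
theorem exists_edgeBoundary_eq_single [DecidableEq T.InteriorVertex] (γ₀ : T.InteriorVertex) :
    ∃ e : T.InteriorEdge → ℤ, edgeBoundary e = Pi.single γ₀ 1 := by
  classical
  by_contra hcon
  obtain ⟨γ, hγ, hmax⟩ := Finset.exists_max_image
    (Finset.univ.filter fun γ : T.InteriorVertex =>
      ¬ ∃ e : T.InteriorEdge → ℤ, edgeBoundary e = Pi.single γ 1)
    (fun γ => γ.1.1.1 + γ.1.1.2) ⟨γ₀, by simpa using hcon⟩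
  simp only [Finset.mem_filter, Finset.mem_univ, true_and] at hγ hmax
  refine hγ ?_
  obtain ⟨τ, hτ⟩ := exists_edge_start γ
  have hint : T.IsInteriorEdge τ := isInteriorEdge_of_mem γ.2 (hτ ▸ τ.1.start_mem)
  have hlt : γ.1.1.1 + γ.1.1.2 < τ.1.finish.1 + τ.1.finish.2 := by
    rw [← hτ]
    have := τ.1.lt
    simp only [Seg.start, Seg.finish, Seg.point_eq]
    cases τ.1.dir <;> simp [Dir.mk] <;> exact this
  have hsingle : ∀ γ' : T.InteriorVertex,
      edgeBoundary (Pi.single ⟨τ, hint⟩ (1 : ℤ)) γ' = intIncidence τ γ'.1 := by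
    intro γ'
    unfold edgeBoundary
    rw [Finset.sum_eq_single ⟨τ, hint⟩]
    · simp
    · intro τ' _ hne
      simp [hne]
    · simp
  have hsub : ∀ (e e' : T.InteriorEdge → ℤ) γ', edgeBoundary (e - e') γ' =
      edgeBoundary e γ' - edgeBoundary e' γ' := by
    intro e e' γ'
    simp [edgeBoundary, mul_sub, Finset.sum_sub_distrib]
  by_cases hf : τ.1.finish ∈ interior T.domain
  · set γ' : T.InteriorVertex := ⟨endVertex τ false, hf⟩ with hγ'
    obtain ⟨e, he⟩ : ∃ e : T.InteriorEdge → ℤ, edgeBoundary e = Pi.single γ' 1 := by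
      by_contra h
      exact absurd (hmax γ' h) (not_le.2 hlt)
    refine ⟨e - Pi.single ⟨τ, hint⟩ 1, funext fun δ => ?_⟩
    rw [hsub, hsingle, he]
    have h1 : (τ.1.finish = δ.1.1) ↔ δ = γ' :=
      ⟨fun h => Subtype.ext (Subtype.ext h.symm), fun h => by rw [h]; rfl⟩
    have h2 : (τ.1.start = δ.1.1) ↔ δ = γ :=
      ⟨fun h => Subtype.ext (Subtype.ext (h.symm.trans hτ)), fun h => by rw [h, hτ]⟩
    simp only [intIncidence, h1, h2, Pi.single_apply]
    ring
  · refine ⟨-Pi.single ⟨τ, hint⟩ 1, funext fun δ => ?_⟩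
    rw [← zero_sub, hsub, hsingle]
    have h1 : τ.1.finish ≠ δ.1.1 := fun h => hf (h ▸ δ.2)
    have h2 : (τ.1.start = δ.1.1) ↔ δ = γ :=
      ⟨fun h => Subtype.ext (Subtype.ext (h.symm.trans hτ)), fun h => by rw [h, hτ]⟩
    simp only [intIncidence, h1, h2, Pi.single_apply]
    simp [edgeBoundary]

end TMesh

/-! ### Patching functions that agree up to integers -/

/-- A space with a finite closed cover by locally path-connected sets is locally path-connected. -/
theorem locallyPathConnectedSpace_of_closed_cover {X ι : Type*} [TopologicalSpace X] [Finite ι]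
    (K : ι → Set X) (hK : ∀ i, IsClosed (K i)) (hcov : ∀ x, ∃ i, x ∈ K i)
    (hlpc : ∀ i, LocallyPathConnectedSpace (K i)) : LocallyPathConnectedSpace X := by
  let f : (Σ i, K i) → X := fun p => p.2.1
  have hcont : Continuous f := continuous_sigma fun i => continuous_subtype_val
  have hclosed : IsClosedMap f := by
    intro S hS
    rw [isClosed_sigma_iff] at hS
    have : f '' S = ⋃ i, Subtype.val '' {y : K i | (⟨i, y⟩ : Σ i, K i) ∈ S} := by
      ext x
      simp only [Set.mem_image, Set.mem_iUnion, Set.mem_ofPred_eq]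
      constructor
      · rintro ⟨⟨i, y⟩, h, rfl⟩
        exact ⟨i, y, h, rfl⟩
      · rintro ⟨i, y, h, rfl⟩
        exact ⟨⟨i, y⟩, h, rfl⟩
    rw [this]
    exact isClosed_iUnion_of_finite fun i => (hK i).isClosedMap_subtype_val _ (hS i)
  have hsurj : Function.Surjective f := fun x => by
    obtain ⟨i, hi⟩ := hcov x
    exact ⟨⟨i, x, hi⟩, rfl⟩
  exact (hclosed.isQuotientMap hcont hsurj).locallyPathConnectedSpace

/-- On a simply connected space, a family of continuous functions on the pieces of a finite closed
cover that agree up to integers on the overlaps can be made to agree by adding integers: modulo one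
the functions define a map to the circle, which lifts to the real line. -/
theorem exists_int_of_closed_cover {X ι : Type*} [TopologicalSpace X] [SimplyConnectedSpace X]
    [LocallyPathConnectedSpace X] [Finite ι] (K : ι → Set X) (hK : ∀ i, IsClosed (K i))
    (hcov : ∀ x, ∃ i, x ∈ K i) (hpre : ∀ i, IsPreconnected (K i)) (φ : ι → X → ℝ)
    (hφ : ∀ i, Continuous (φ i))
    (hint : ∀ i j x, x ∈ K i → x ∈ K j → ∃ n : ℤ, φ i x - φ j x = n) :
    ∃ n : ι → ℤ, ∀ i j x, x ∈ K i → x ∈ K j → φ i x - φ j x = n i - n j := by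
  choose k hk using hcov
  let θ : X → AddCircle (1 : ℝ) := fun x => (φ (k x) x : ℝ)
  have hθ : ∀ i x, x ∈ K i → θ x = ((φ i x : ℝ) : AddCircle (1 : ℝ)) := by
    intro i x hx
    obtain ⟨n, hn⟩ := hint (k x) i x (hk x) hx
    rw [← sub_eq_zero]
    change ((φ (k x) x : ℝ) : AddCircle (1 : ℝ)) - ((φ i x : ℝ) : AddCircle (1 : ℝ)) = 0
    rw [← AddCircle.coe_sub, hn, AddCircle.coe_eq_zero_iff]
    exact ⟨n, by simp⟩
  have hθc : Continuous θ := by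
    refine (locallyFinite_of_finite K).continuous (Set.eq_univ_of_forall fun x =>
      Set.mem_iUnion.2 ⟨k x, hk x⟩) hK fun i => ?_
    have : ContinuousOn (fun x => ((φ i x : ℝ) : AddCircle (1 : ℝ))) (K i) :=
      ((AddCircle.continuous_mk' (1 : ℝ)).comp (hφ i)).continuousOn
    exact this.congr fun x hx => hθ i x hx
  obtain ⟨x₀⟩ : Nonempty X := inferInstance
  obtain ⟨F, ⟨-, hF⟩, -⟩ := (AddCircle.isCoveringMap_coe (1 : ℝ)).existsUnique_continuousMap_lifts
    ⟨θ, hθc⟩ x₀ (φ (k x₀) x₀) rfl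
  have hF' : ∀ i x, x ∈ K i → ∃ n : ℤ, φ i x - F x = n := by
    intro i x hx
    have h1 : ((F x : ℝ) : AddCircle (1 : ℝ)) = θ x := congrFun hF x
    rw [hθ i x hx, eq_comm, ← sub_eq_zero, ← AddCircle.coe_sub, AddCircle.coe_eq_zero_iff] at h1
    obtain ⟨n, hn⟩ := h1
    exact ⟨n, by rw [← hn]; simp⟩
  have hconst : ∀ i, ∃ n : ℤ, ∀ x ∈ K i, φ i x - F x = n := by
    intro i
    have hd : IsDiscrete (Set.range ((↑) : ℤ → ℝ)) :=
      Int.isClosedEmbedding_coe_real.isEmbedding.isDiscrete_range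
    obtain ⟨y, ⟨n, rfl⟩, hy⟩ := (hpre i).eqOn_const_of_mapsTo hd
      ((hφ i).sub F.continuous).continuousOn (fun x hx => by
        obtain ⟨n, hn⟩ := hF' i x hx
        exact ⟨n, hn.symm⟩) ⟨0, 0, by simp⟩
    exact ⟨n, fun x hx => hy hx⟩
  choose n hn using hconst
  refine ⟨n, fun i j x hi hj => ?_⟩
  rw [← hn i x hi, ← hn j x hj]
  ring

namespace TMesh

variable {T : TMesh}

/-! ### Exactness of the relative chain complex -/

theorem locallyPathConnectedSpace_domain : LocallyPathConnectedSpace T.domain := by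
  refine locallyPathConnectedSpace_of_closed_cover
    (fun σ : T.Face => {x : T.domain | (x : ℝ × ℝ) ∈ closure σ.1.cell})
    (fun σ => isClosed_closure.preimage continuous_subtype_val) (fun x => ?_) fun σ => ?_
  · obtain ⟨σ, hσ, h⟩ := mem_domain.1 x.2
    exact ⟨⟨σ, hσ⟩, h⟩
  · have h1 := σ.1.convex_closure.locallyPathConnectedSpace
    let e : closure σ.1.cell → {x : T.domain | (x : ℝ × ℝ) ∈ closure σ.1.cell} :=
      fun x => ⟨⟨x.1, mem_domain.2 ⟨σ.1, σ.2, x.2⟩⟩, x.2⟩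
    have he : Continuous e := by
      refine Continuous.subtype_mk (Continuous.subtype_mk continuous_subtype_val _) _
    let e' : {x : T.domain | (x : ℝ × ℝ) ∈ closure σ.1.cell} → closure σ.1.cell :=
      fun x => ⟨x.1.1, x.2⟩
    have he' : Continuous e' :=
      Continuous.subtype_mk (continuous_subtype_val.comp continuous_subtype_val) _
    exact (Homeomorph.mk ⟨e, e', fun _ => rfl, fun _ => rfl⟩ he he').isQuotientMap
      |>.locallyPathConnectedSpace

open Classical in
/-- A function that vanishes on the edges that do not contain `γ` and at the vertices other than
`γ`, and nowhere else. -/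
noncomputable def vertexWeight (γ : T.Vertex) (x : ℝ × ℝ) : ℝ :=
  (∏ τ : T.Edge with γ.1 ∉ τ.1.carrier, Metric.infDist x τ.1.carrier) *
    ∏ γ' : T.Vertex with γ' ≠ γ, dist x γ'.1

theorem continuous_vertexWeight (γ : T.Vertex) : Continuous (vertexWeight γ) := by
  unfold vertexWeight
  refine Continuous.mul (continuous_finsetProd _ fun τ _ => Metric.continuous_infDist_pt _)
    (continuous_finsetProd _ fun γ' _ => continuous_id.dist continuous_const)

theorem vertexWeight_nonneg (γ : T.Vertex) (x : ℝ × ℝ) : 0 ≤ vertexWeight γ x :=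
  mul_nonneg (Finset.prod_nonneg fun _ _ => Metric.infDist_nonneg)
    (Finset.prod_nonneg fun _ _ => dist_nonneg)

theorem vertexWeight_ne_zero {γ : T.Vertex} {x : ℝ × ℝ} : vertexWeight γ x ≠ 0 ↔
    (∀ τ : T.Edge, x ∈ τ.1.carrier → γ.1 ∈ τ.1.carrier) ∧
      ∀ γ' : T.Vertex, x = γ'.1 → γ' = γ := by
  unfold vertexWeight
  rw [mul_ne_zero_iff, Finset.prod_ne_zero_iff, Finset.prod_ne_zero_iff]
  refine and_congr (forall_congr' fun τ => ?_) (forall_congr' fun γ' => ?_)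
  · have := τ.1.isCompact_carrier.isClosed.mem_iff_infDist_zero (x := x) ⟨_, τ.1.start_mem⟩
    simp only [Finset.mem_filter, Finset.mem_univ, true_and]
    tauto
  · simp only [Finset.mem_filter, Finset.mem_univ, true_and, ne_eq, dist_eq_zero]
    tauto

theorem sum_vertexWeight_pos (hT : T.faces.Nonempty) (x : ℝ × ℝ) :
    0 < ∑ γ : T.Vertex, vertexWeight γ x := by
  obtain ⟨γ, hγ⟩ : ∃ γ : T.Vertex, vertexWeight γ x ≠ 0 := by
    by_cases hx : ∃ γ : T.Vertex, x = γ.1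
    · obtain ⟨γ, rfl⟩ := hx
      exact ⟨γ, vertexWeight_ne_zero.2 ⟨fun _ h => h, fun γ' h => Subtype.ext h.symm⟩⟩
    by_cases hx' : ∃ τ : T.Edge, x ∈ τ.1.carrier
    · obtain ⟨τ, hτ⟩ := hx'
      refine ⟨endVertex τ true, vertexWeight_ne_zero.2 ⟨fun τ' h => ?_, fun γ' h =>
        absurd ⟨γ', h⟩ hx⟩⟩
      rcases Seg.eq_or_mem_relInterior hτ with h1 | h1 | h1
      · exact absurd ⟨endVertex τ true, h1⟩ hx
      · exact absurd ⟨endVertex τ false, h1⟩ hx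
      · rw [edge_eq_of_mem_relInterior τ.2 τ'.2 h1 h]
        exact τ.1.endpt_mem true
    · obtain ⟨σ, hσ⟩ := hT
      obtain ⟨E, hE, hfr⟩ := T.frontier_eq σ hσ
      have h1 : ((σ.x₀, σ.y₀) : ℝ × ℝ) ∈ frontier σ.cell := by
        rw [Rect.frontier_cell, Rect.closure_cell]
        exact ⟨by simp [σ.x_lt.le, σ.y_lt.le], fun h => lt_irrefl _ h.1.1⟩
      rw [hfr] at h1
      simp only [Set.mem_iUnion] at h1
      obtain ⟨τ, hτ, -⟩ := h1
      exact ⟨endVertex ⟨τ, hE hτ⟩ true, vertexWeight_ne_zero.2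
        ⟨fun τ' h => absurd ⟨τ', h⟩ hx', fun γ' h => absurd ⟨γ', h⟩ hx⟩⟩
  exact Finset.sum_pos' (fun γ _ => vertexWeight_nonneg γ x)
    ⟨γ, Finset.mem_univ _, lt_of_le_of_ne (vertexWeight_nonneg γ x) hγ.symm⟩

/-- The weights, normalized to a partition of unity. -/
noncomputable def vertexBump (γ : T.Vertex) (x : ℝ × ℝ) : ℝ :=
  vertexWeight γ x / ∑ γ' : T.Vertex, vertexWeight γ' x

theorem sum_vertexBump (hT : T.faces.Nonempty) (x : ℝ × ℝ) :
    ∑ γ : T.Vertex, vertexBump γ x = 1 := by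
  unfold vertexBump
  rw [← Finset.sum_div, div_self (sum_vertexWeight_pos hT x).ne']

theorem continuous_vertexBump (hT : T.faces.Nonempty) (γ : T.Vertex) :
    Continuous (vertexBump γ) :=
  (continuous_vertexWeight γ).div (continuous_finsetSum _ fun γ _ => continuous_vertexWeight γ)
    fun x => (sum_vertexWeight_pos hT x).ne'

theorem vertexBump_ne_zero {γ : T.Vertex} {x : ℝ × ℝ} (h : vertexBump γ x ≠ 0) :
    vertexWeight γ x ≠ 0 := fun h' => h (by rw [vertexBump, h', zero_div])

/-- Exactness in the middle for integer chains: on a simply connected domain every relative cycle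
of edges is the boundary of a chain of faces. The local primitives at the vertices are patched by a
partition of unity to a function on every closed face, and these functions agree up to integers. -/
theorem exists_int_primitive (hT : T.IsSimplyConnected) (z : T.InteriorEdge → ℤ)
    (hz : ∀ γ, edgeBoundary (fun τ => Dir.sign τ.1.1.dir • z τ) γ = 0) :
    ∃ u : T.Face → ℤ, jump u = z := by
  have hne : T.faces.Nonempty := by
    obtain ⟨x, hx⟩ := T.connected.1
    obtain ⟨σ, hσ, -⟩ := mem_domain.1 hx
    exact ⟨σ, hσ⟩
  choose c hc using exists_local_primitive z hz
  have := hT.domain_simplyConnected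
  have := T.locallyPathConnectedSpace_domain
  set φ : T.Face → ℝ × ℝ → ℝ := fun σ x => ∑ γ : T.Vertex, vertexBump γ x * c γ σ with hφ
  have hφc : ∀ σ, Continuous (φ σ) := fun σ =>
    continuous_finsetSum _ fun γ _ => (continuous_vertexBump hne γ).mul continuous_const
  -- on an interior edge the functions on both sides differ by the value of the chain
  have hedge : ∀ (τ : T.InteriorEdge) (x : ℝ × ℝ), x ∈ τ.1.1.carrier →
      φ (sideFace τ true) x - φ (sideFace τ false) x = z τ := by
    intro τ x hx
    have h1 : ∀ γ : T.Vertex, vertexBump γ x * c γ (sideFace τ true) -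
        vertexBump γ x * c γ (sideFace τ false) = vertexBump γ x * z τ := by
      intro γ
      by_cases h : vertexBump γ x = 0
      · simp [h]
      · have h2 := hc γ τ ((vertexWeight_ne_zero.1 (vertexBump_ne_zero h)).1 τ.1 hx)
        rw [← h2, jump]
        push_cast
        ring
    simp only [hφ]
    rw [← Finset.sum_sub_distrib, Finset.sum_congr rfl fun γ _ => h1 γ, ← Finset.sum_mul,
      sum_vertexBump hne, one_mul]
  have hvert : ∀ (σ : T.Face) (γ : T.Vertex), φ σ γ.1 = c γ σ := by
    intro σ γ
    have h0 : ∀ γ' : T.Vertex, γ' ≠ γ → vertexBump γ' γ.1 = 0 := by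
      intro γ' h
      by_contra h1
      exact h ((vertexWeight_ne_zero.1 (vertexBump_ne_zero h1)).2 γ rfl).symm
    have h1 := sum_vertexBump hne γ.1
    rw [Finset.sum_eq_single γ (fun γ' _ h => h0 γ' h) (by simp)] at h1
    simp only [hφ]
    rw [Finset.sum_eq_single γ (fun γ' _ h => by rw [h0 γ' h, zero_mul]) (by simp), h1, one_mul]
  obtain ⟨n, hn⟩ := exists_int_of_closed_cover
    (fun σ : T.Face => {x : T.domain | (x : ℝ × ℝ) ∈ closure σ.1.cell})
    (fun σ => isClosed_closure.preimage continuous_subtype_val)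
    (fun x => by
      obtain ⟨σ, hσ, h⟩ := mem_domain.1 x.2
      exact ⟨⟨σ, hσ⟩, h⟩)
    (fun σ => by
      rw [← Topology.IsInducing.subtypeVal.isPreconnected_image]
      convert σ.1.convex_closure.isPreconnected using 1
      ext x
      constructor
      · rintro ⟨y, hy, rfl⟩
        exact hy
      · intro hx
        exact ⟨⟨x, mem_domain.2 ⟨σ.1, σ.2, hx⟩⟩, hx, rfl⟩)
    (fun σ x => φ σ x) (fun σ => (hφc σ).comp continuous_subtype_val)
    (by
      rintro σ σ' ⟨x, hxd⟩ (hx : x ∈ closure σ.1.cell) (hx' : x ∈ closure σ'.1.cell)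
      by_cases hσ : σ = σ'
      · exact ⟨0, by simp [hσ]⟩
      have hfr := frontier_of_mem_closure σ.2 σ'.2 (fun h => hσ (Subtype.ext h)) hx hx'
      obtain ⟨E, hE, hEfr⟩ := T.frontier_eq σ.1 σ.2
      rw [hEfr] at hfr
      simp only [Set.mem_iUnion] at hfr
      obtain ⟨τ, hτ, hxτ⟩ := hfr
      have hvertex : ∀ γ : T.Vertex, x = γ.1 → ∃ n : ℤ, φ σ x - φ σ' x = n := by
        rintro γ rfl
        exact ⟨c γ σ - c γ σ', by rw [hvert, hvert]; push_cast; ring⟩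
      rcases Seg.eq_or_mem_relInterior hxτ with h | h | h
      · exact hvertex (endVertex ⟨τ, hE hτ⟩ true) h
      · exact hvertex (endVertex ⟨τ, hE hτ⟩ false) h
      · obtain ⟨hint, t, h1, h2⟩ :=
          exists_sideFace_of_mem_relInterior hσ (τ := ⟨τ, hE hτ⟩) h hx hx'
        have h3 := hedge ⟨⟨τ, hE hτ⟩, hint⟩ x hxτ
        cases t
        · refine ⟨-z ⟨⟨τ, hE hτ⟩, hint⟩, ?_⟩
          push_cast
          rw [← h3, h1, h2]
          simp
        · exact ⟨z ⟨⟨τ, hE hτ⟩, hint⟩, by rw [← h3, h1, h2]; simp⟩)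
  refine ⟨n, funext fun τ => ?_⟩
  have hm := fun t => (sideFace_borders τ t).mem_closure τ.1.1.start_mem
  have h1 := hn (sideFace τ true) (sideFace τ false)
    ⟨τ.1.1.start, mem_domain.2 ⟨_, (sideFace τ true).2, hm true⟩⟩ (hm true) (hm false)
  have h2 := hedge τ τ.1.1.start τ.1.1.start_mem
  have h3 : ((jump n τ : ℤ) : ℝ) = z τ := by
    rw [jump, ← h2]
    push_cast
    exact h1.symm
  exact_mod_cast h3

theorem map_edgeBoundary {V W : Type*} [AddCommGroup V] [AddCommGroup W] (f : V →+ W)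
    (z : T.InteriorEdge → V) (γ : T.InteriorVertex) :
    edgeBoundary (fun τ => f (z τ)) γ = f (edgeBoundary z γ) := by
  simp [edgeBoundary, map_sum, map_zsmul]

/-- Exactness in the middle for rational chains, by clearing denominators. -/
theorem exists_rat_primitive (hT : T.IsSimplyConnected) (z : T.InteriorEdge → ℚ)
    (hz : ∀ γ, edgeBoundary (fun τ => Dir.sign τ.1.1.dir • z τ) γ = 0) :
    ∃ u : T.Face → ℚ, jump u = z := by
  set N : ℤ := ∏ τ, ((z τ).den : ℤ) with hN
  have hN0 : (N : ℚ) ≠ 0 := by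
    rw [hN]
    push_cast
    exact Finset.prod_ne_zero_iff.2 fun τ _ => by exact_mod_cast (z τ).den_ne_zero
  have hint : ∀ τ, ∃ n : ℤ, (n : ℚ) = N * z τ := by
    intro τ
    obtain ⟨k, hk⟩ := Finset.dvd_prod_of_mem (fun τ => ((z τ).den : ℤ)) (Finset.mem_univ τ)
    refine ⟨k * (z τ).num, ?_⟩
    rw [hN, hk]
    push_cast
    have := Rat.mul_den_eq_num (z τ)
    rw [← this]
    ring
  choose w hw using hint
  obtain ⟨u, hu⟩ := exists_int_primitive hT w fun γ => by
    have h1 := map_edgeBoundary (Int.castAddHom ℚ) (fun τ => Dir.sign τ.1.1.dir • w τ) γ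
    have h2 := map_edgeBoundary (AddMonoidHom.mulLeft (N : ℚ))
      (fun τ => Dir.sign τ.1.1.dir • z τ) γ
    rw [hz, map_zero] at h2
    have h3 : (Int.castAddHom ℚ) (edgeBoundary (fun τ => Dir.sign τ.1.1.dir • w τ) γ) = 0 := by
      rw [← h1, ← h2]
      congr 1
      funext τ
      simp only [Int.coe_castAddHom, AddMonoidHom.coe_mulLeft, zsmul_eq_mul, Int.cast_mul, hw,
        Int.cast_id]
      ring
    simpa using h3
  refine ⟨fun σ => u σ / N, funext fun τ => ?_⟩
  have h1 := congrFun hu τ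
  simp only [jump] at h1 ⊢
  rw [← sub_div, div_eq_iff hN0, mul_comm, ← hw, ← h1]
  push_cast
  rfl

/-- Exactness in the middle with coefficients in a rational vector space, by applying the rational
case to the coordinates with respect to a basis. -/
theorem exists_primitive (hT : T.IsSimplyConnected) {V : Type*} [AddCommGroup V] [Module ℚ V]
    (z : T.InteriorEdge → V)
    (hz : ∀ γ, edgeBoundary (fun τ => Dir.sign τ.1.1.dir • z τ) γ = 0) :
    ∃ u : T.Face → V, jump u = z := by
  classical
  set b := Module.Basis.ofVectorSpace ℚ V
  have hi : ∀ i, ∃ u : T.Face → ℚ, jump u = fun τ => b.repr (z τ) i := fun i =>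
    exists_rat_primitive hT _ fun γ => by
      have h := map_edgeBoundary ((b.coord i).toAddMonoidHom)
        (fun τ => Dir.sign τ.1.1.dir • z τ) γ
      rw [hz, map_zero] at h
      rw [← h]
      congr 1
      funext τ
      simp
  choose u hu using hi
  set S := Finset.univ.biUnion fun τ => (b.repr (z τ)).support with hS
  refine ⟨fun σ => ∑ i ∈ S, u i σ • b i, funext fun τ => ?_⟩
  simp only [jump]
  rw [← Finset.sum_sub_distrib]
  have h1 : ∀ i ∈ S, u i (sideFace τ true) • b i - u i (sideFace τ false) • b i =
      b.repr (z τ) i • b i := by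
    intro i _
    rw [← sub_smul]
    congr 1
    exact congrFun (hu i) τ
  rw [Finset.sum_congr rfl h1]
  conv_rhs => rw [← b.linearCombination_repr (z τ), Finsupp.linearCombination_apply]
  exact (Finsupp.sum_of_support_subset (b.repr (z τ))
    (Finset.subset_biUnion_of_mem (fun τ => (b.repr (z τ)).support) (Finset.mem_univ τ))
    (fun i a => a • b i) fun i _ => zero_smul ℚ (b i)).symm

/-- Surjectivity of the relative boundary from edges to vertices. -/
theorem exists_edgeBoundary_eq {V : Type*} [AddCommGroup V] (w : T.InteriorVertex → V) :
    ∃ z : T.InteriorEdge → V, edgeBoundary z = w := by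
  classical
  choose e he using fun γ₀ : T.InteriorVertex => exists_edgeBoundary_eq_single γ₀
  refine ⟨fun τ => ∑ γ₀, e γ₀ τ • w γ₀, funext fun γ => ?_⟩
  have h1 : edgeBoundary (fun τ => ∑ γ₀, e γ₀ τ • w γ₀) γ =
      ∑ γ₀, edgeBoundary (e γ₀) γ • w γ₀ := by
    unfold edgeBoundary
    simp only [Finset.smul_sum, Finset.sum_smul, smul_smul, smul_eq_mul]
    exact Finset.sum_comm
  rw [h1]
  simp [he, Pi.single_apply]

end TMesh

/-! ### Dimensions of the spaces of polynomials -/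

open MvPolynomial

theorem MvPolynomial.restrictSupport_iUnion {σ R : Type*} {ι : Sort*} [CommSemiring R]
    (S : ι → Set (σ →₀ ℕ)) :
    restrictSupport R (⋃ i, S i) = ⨆ i, restrictSupport R (S i) := by
  simp only [restrictSupport_eq_span, Set.image_iUnion, Submodule.span_iUnion]

theorem MvPolynomial.finrank_restrictSupport {σ R : Type*} [Field R] (S : Set (σ →₀ ℕ)) :
    Module.finrank R (restrictSupport R S) = S.ncard :=
  Module.finrank_eq_nat_card_basis (basisRestrictSupport R S)

/-- The exponents below `(A, B)`. -/
def expBox (A B : ℕ) : Set (Fin 2 →₀ ℕ) := {e | e 0 < A ∧ e 1 < B}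

theorem expBox_eq (A B : ℕ) : expBox A B =
    ((finTwoArrowEquiv ℕ).symm.trans Finsupp.equivFunOnFinite.symm) '' (Set.Iio A ×ˢ Set.Iio B) := by
  ext e
  rw [((finTwoArrowEquiv ℕ).symm.trans Finsupp.equivFunOnFinite.symm).image_eq_preimage_symm]
  rfl

theorem finite_expBox (A B : ℕ) : (expBox A B).Finite := by
  rw [expBox_eq]
  exact ((Set.finite_Iio A).prod (Set.finite_Iio B)).image _

theorem ncard_expBox (A B : ℕ) : (expBox A B).ncard = A * B := by
  rw [expBox_eq, Set.ncard_image_of_injective _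
    ((finTwoArrowEquiv ℕ).symm.trans Finsupp.equivFunOnFinite.symm).injective, Set.ncard_prod]
  simp

theorem biDegree_eq (m m' : ℕ) : biDegree m m' = restrictSupport ℝ (expBox (m + 1) (m' + 1)) := by
  rw [restrictSupport_eq_span, biDegree]
  congr 1
  ext p
  have hmon : ∀ e : Fin 2 →₀ ℕ, (monomial e (1 : ℝ) : Poly₂) = X 0 ^ e 0 * X 1 ^ e 1 := by
    intro e
    rw [monomial_eq]
    simp [Finsupp.prod_fintype]
  constructor
  · rintro ⟨i, j, hi, hj, rfl⟩
    refine ⟨Finsupp.equivFunOnFinite.symm ![i, j], ?_, ?_⟩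
    · simp [expBox]; omega
    · simp [hmon]
  · rintro ⟨e, he, rfl⟩
    exact ⟨e 0, e 1, Nat.lt_succ_iff.1 he.1, Nat.lt_succ_iff.1 he.2, hmon e⟩

theorem mem_biDegree {m m' : ℕ} {p : Poly₂} :
    p ∈ biDegree m m' ↔ p.degreeOf 0 ≤ m ∧ p.degreeOf 1 ≤ m' := by
  rw [biDegree_eq, mem_restrictSupport_iff, degreeOf_le_iff, degreeOf_le_iff, ← forall₂_and]
  refine forall₂_congr fun e _ => ?_
  simp [expBox]

instance (m m' : ℕ) : Module.Finite ℝ (biDegree m m') := by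
  rw [biDegree_eq]
  have := (finite_expBox (m + 1) (m' + 1)).to_subtype
  exact Module.Finite.of_basis (basisRestrictSupport ℝ _)

theorem finrank_biDegree (m m' : ℕ) : Module.finrank ℝ (biDegree m m') = (m + 1) * (m' + 1) := by
  rw [biDegree_eq, finrank_restrictSupport, ncard_expBox]

/-- The substitution that moves the point `(a, b)` to the origin. -/
noncomputable def translateHom (a b : ℝ) : Poly₂ →ₐ[ℝ] Poly₂ :=
  aeval ![X 0 + C a, X 1 + C b]

theorem translateHom_comp (a b : ℝ) :
    (translateHom a b).comp (translateHom (-a) (-b)) = AlgHom.id ℝ _ := by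
  refine algHom_ext fun i => ?_
  fin_cases i <;> simp [translateHom, algebraMap_eq]

/-- The substitution that moves the point `(a, b)` to the origin, as an automorphism. -/
noncomputable def translateEquiv (a b : ℝ) : Poly₂ ≃ₐ[ℝ] Poly₂ :=
  AlgEquiv.ofAlgHom (translateHom a b) (translateHom (-a) (-b)) (translateHom_comp a b)
    (by simpa using translateHom_comp (-a) (-b))

theorem translateHom_mem_biDegree {m m' : ℕ} (a b : ℝ) {p : Poly₂} (hp : p ∈ biDegree m m') :
    translateHom a b p ∈ biDegree m m' := by
  unfold biDegree at hp
  induction hp using Submodule.span_induction with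
  | mem p hp =>
    obtain ⟨i, j, hi, hj, rfl⟩ := hp
    have hd : ∀ n k : Fin 2, ∀ c : ℝ, degreeOf n (X k + C c : Poly₂) ≤ if n = k then 1 else 0 := by
      intro n k c
      refine (degreeOf_add_le _ _ _).trans ?_
      rw [degreeOf_C, degreeOf_X]
      simp
    have h : translateHom a b (X 0 ^ i * X 1 ^ j) = (X 0 + C a) ^ i * (X 1 + C b) ^ j := by
      simp [translateHom]
    rw [h, mem_biDegree]
    have key : ∀ n, degreeOf n ((X 0 + C a) ^ i * (X 1 + C b) ^ j : Poly₂) ≤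
        i * (if n = 0 then 1 else 0) + j * (if n = 1 then 1 else 0) := by
      intro n
      refine (degreeOf_mul_le _ _ _).trans (add_le_add ?_ ?_)
      · exact (degreeOf_pow_le _ _ _).trans (Nat.mul_le_mul_left _ (hd _ _ _))
      · exact (degreeOf_pow_le _ _ _).trans (Nat.mul_le_mul_left _ (hd _ _ _))
    exact ⟨(key 0).trans (by simpa using hi), (key 1).trans (by simpa using hj)⟩
  | zero => simp
  | add p q _ _ hp hq => rw [map_add]; exact add_mem hp hq
  | smul c p _ hp => rw [map_smul]; exact Submodule.smul_mem _ c hp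

theorem translate_mem_biDegree {m m' : ℕ} (a b : ℝ) {p : Poly₂} :
    translateEquiv a b p ∈ biDegree m m' ↔ p ∈ biDegree m m' := by
  refine ⟨fun h => ?_, translateHom_mem_biDegree a b⟩
  have h1 := translateHom_mem_biDegree (-a) (-b) h
  rwa [show translateHom (-a) (-b) (translateEquiv a b p) = p from
    (translateEquiv a b).symm_apply_apply p] at h1

/-- The index of the variable that is constant along the direction `d`. -/
def Dir.normal : Dir → Fin 2
  | Dir.horizontal => 1
  | Dir.vertical => 0

theorem Seg.linearForm_eq (τ : Seg) : τ.linearForm = X τ.dir.normal - C τ.c := by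
  rcases τ with ⟨d, c, a, b, h⟩
  cases d <;> rfl

theorem translate_linearForm {τ : Seg} {p : ℝ × ℝ} (hp : p ∈ τ.carrier) :
    translateEquiv p.1 p.2 τ.linearForm = X τ.dir.normal := by
  have h := (Seg.mem_carrier.1 hp).2
  rw [τ.linearForm_eq]
  change translateHom p.1 p.2 _ = _
  cases hd : τ.dir <;> rw [hd] at h <;> simp only [Dir.flip, Dir.coord] at h <;>
    simp [translateHom, Dir.normal, h, algebraMap_eq]

theorem mem_span_X_pow {i : Fin 2} {k : ℕ} {p : Poly₂} :
    p ∈ Ideal.span {(X i : Poly₂) ^ k} ↔ ∀ e ∈ p.support, k ≤ e i := by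
  have h := mem_ideal_span_monomial_image (x := p) (s := {Finsupp.single i k})
  rw [Set.image_singleton, ← X_pow_eq_monomial] at h
  rw [h]
  simp [Finsupp.single_le_iff]

namespace TMesh

variable {T : TMesh} {m m' : ℕ} {r : T.Smoothness}

theorem map_edgeIdeal (τ : T.Edge) {p : ℝ × ℝ} (hp : p ∈ τ.1.carrier) :
    (edgeIdeal m m' r τ).map (translateEquiv p.1 p.2).toLinearEquiv.toLinearMap =
      restrictSupport ℝ (expBox (m + 1) (m' + 1) ∩
        {e | (r.order τ + 1).toNat ≤ e τ.1.dir.normal}) := by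
  ext q
  obtain ⟨q, rfl⟩ := (translateEquiv p.1 p.2).surjective q
  have h1 : translateEquiv p.1 p.2 q ∈ (edgeIdeal m m' r τ).map
      (translateEquiv p.1 p.2).toLinearEquiv.toLinearMap ↔ q ∈ edgeIdeal m m' r τ := by
    constructor
    · rintro ⟨q', hq', he⟩
      rwa [← (translateEquiv p.1 p.2).injective he]
    · exact fun h => ⟨q, h, rfl⟩
  rw [h1, edgeIdeal, Submodule.mem_inf, ← translate_mem_biDegree p.1 p.2, biDegree_eq,
    Submodule.restrictScalars_mem, Ideal.mem_span_singleton,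
    ← map_dvd_iff (translateEquiv p.1 p.2), map_pow, translate_linearForm hp,
    ← Ideal.mem_span_singleton, mem_span_X_pow, mem_restrictSupport_iff, mem_restrictSupport_iff,
    Set.subset_inter_iff]
  rfl

theorem map_vertexIdeal (γ : T.Vertex) :
    (vertexIdeal m m' r γ).map (translateEquiv γ.1.1 γ.1.2).toLinearEquiv.toLinearMap =
      restrictSupport ℝ (⋃ (τ : T.Edge) (_ : γ.1 ∈ τ.1.carrier), expBox (m + 1) (m' + 1) ∩
        {e | (r.order τ + 1).toNat ≤ e τ.1.dir.normal}) := by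
  rw [vertexIdeal, Submodule.map_iSup, restrictSupport_iUnion]
  refine iSup_congr fun τ => ?_
  rw [Submodule.map_iSup, restrictSupport_iUnion]
  exact iSup_congr fun h => map_edgeIdeal τ h

theorem edgeIdeal_le (τ : T.Edge) : edgeIdeal m m' r τ ≤ biDegree m m' := inf_le_left

theorem vertexIdeal_le (γ : T.Vertex) : vertexIdeal m m' r γ ≤ biDegree m m' :=
  iSup₂_le fun τ _ => edgeIdeal_le τ

/-- The codimension of a space of polynomials that becomes monomial after a linear change of
variables is the number of missing monomials. -/
theorem finrank_quotient_submoduleOf {J : Submodule ℝ Poly₂} (hJ : J ≤ biDegree m m')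
    (f : Poly₂ ≃ₗ[ℝ] Poly₂) {S : Set (Fin 2 →₀ ℕ)}
    (hf : J.map f.toLinearMap = restrictSupport ℝ S) {A B : ℕ} (hS : S ⊆ expBox (m + 1) (m' + 1))
    (h : expBox (m + 1) (m' + 1) \ S = expBox A B) :
    Module.finrank ℝ (biDegree m m' ⧸ J.submoduleOf (biDegree m m')) = A * B := by
  have h1 := (J.submoduleOf (biDegree m m')).finrank_quotient_add_finrank
  rw [(Submodule.submoduleOfEquivOfLe hJ).finrank_eq, ← f.finrank_map_eq J, hf,
    finrank_restrictSupport, finrank_biDegree] at h1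
  have h2 := Set.ncard_sdiff_add_ncard_of_subset hS (finite_expBox _ _)
  rw [h, ncard_expBox, ncard_expBox] at h2
  omega

/-- The truncated minimum counts the exponents `n` that are at most `m` and below all the bounds;
the convention for the empty minimum makes the second condition void. -/
theorem lt_toNat_truncate_inf {ι : Type*} (s : Finset ι) (f : ι → ℤ) (m n : ℕ) :
    n < (truncate (s.inf fun i => (f i : WithTop ℤ)) m + 1).toNat ↔
      n ≤ m ∧ ∀ i ∈ s, n < (f i + 1).toNat := by
  have h1 : (n : ℤ) ≤ truncate (s.inf fun i => (f i : WithTop ℤ)) m ↔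
      (n : ℤ) ≤ m ∧ ((n : ℤ) : WithTop ℤ) ≤ s.inf fun i => (f i : WithTop ℤ) := by
    unfold truncate
    rw [le_min_iff, and_comm]
    refine and_congr_right fun hn => ?_
    cases s.inf fun i => (f i : WithTop ℤ) with
    | top => simp [hn]
    | coe x => rw [WithTop.untopD_coe, WithTop.coe_le_coe]
  rw [Int.lt_toNat, Int.lt_add_one_iff, h1, Finset.le_inf_iff]
  simp only [WithTop.coe_le_coe, Int.lt_toNat, Int.lt_add_one_iff, Nat.cast_le]

theorem neg_one_le_truncate_minOrder (d : Dir) (γ : T.Vertex) (n : ℕ) :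
    -1 ≤ truncate (minOrder r d γ) n := by
  have h : ((-1 : ℤ) : WithTop ℤ) ≤ minOrder r d γ :=
    Finset.le_inf fun τ _ => WithTop.coe_le_coe.2 (r.neg_one_le τ)
  unfold truncate
  cases hx : minOrder r d γ with
  | top => simp
  | coe x =>
    rw [hx, WithTop.coe_le_coe] at h
    simp only [WithTop.untopD_coe]
    omega

theorem finrank_quotient_vertexIdeal (γ : T.Vertex) :
    (Module.finrank ℝ (biDegree m m' ⧸ (vertexIdeal m m' r γ).submoduleOf (biDegree m m')) : ℤ) =
      (truncate (rh r γ) m + 1) * (truncate (rv r γ) m' + 1) := by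
  have h := finrank_quotient_submoduleOf (m := m) (m' := m') (vertexIdeal_le γ)
    (translateEquiv γ.1.1 γ.1.2).toLinearEquiv (map_vertexIdeal (r := r) γ)
    (A := (truncate (rh r γ) m + 1).toNat) (B := (truncate (rv r γ) m' + 1).toNat)
    (Set.iUnion₂_subset fun τ _ => Set.inter_subset_left) (by
      ext e
      simp only [Set.mem_sdiff, Set.mem_iUnion, Set.mem_inter_iff, Set.mem_ofPred_eq, expBox, rh,
        rv, minOrder, lt_toNat_truncate_inf, Finset.mem_filter, Finset.mem_univ, true_and,
        not_exists, not_and, not_le]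
      constructor
      · rintro ⟨h1, h2⟩
        refine ⟨⟨Nat.lt_succ_iff.1 h1.1, ?_⟩, Nat.lt_succ_iff.1 h1.2, ?_⟩
        · rintro τ ⟨hd, hτ⟩
          have := h2 τ hτ h1
          rwa [hd] at this
        · rintro τ ⟨hd, hτ⟩
          have := h2 τ hτ h1
          rwa [hd] at this
      · rintro ⟨⟨h1, h2⟩, h3, h4⟩
        refine ⟨⟨Nat.lt_succ_iff.2 h1, Nat.lt_succ_iff.2 h3⟩, fun τ hτ _ => ?_⟩
        cases hd : τ.1.dir
        · exact h4 τ ⟨hd, hτ⟩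
        · exact h2 τ ⟨hd, hτ⟩)
  rw [h]
  push_cast
  have h1 := neg_one_le_truncate_minOrder (r := r) Dir.vertical γ m
  have h2 := neg_one_le_truncate_minOrder (r := r) Dir.horizontal γ m'
  rw [Int.toNat_of_nonneg (by unfold rh; omega), Int.toNat_of_nonneg (by unfold rv; omega)]

/-- The contribution of an edge to the Euler characteristic. -/
noncomputable def edgeTerm (m m' : ℕ) (r : T.Smoothness) (τ : T.Edge) : ℤ :=
  match τ.1.dir with
  | Dir.horizontal => (m + 1) * (min (r.order τ) m' + 1)
  | Dir.vertical => (m' + 1) * (min (r.order τ) m + 1)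

theorem finrank_quotient_edgeIdeal (τ : T.Edge) :
    (Module.finrank ℝ (biDegree m m' ⧸ (edgeIdeal m m' r τ).submoduleOf (biDegree m m')) : ℤ) =
      edgeTerm m m' r τ := by
  have h0 := r.neg_one_le τ
  have h := fun A B => finrank_quotient_submoduleOf (m := m) (m' := m') (edgeIdeal_le τ)
    (translateEquiv τ.1.start.1 τ.1.start.2).toLinearEquiv (map_edgeIdeal (r := r) τ τ.1.start_mem)
    (A := A) (B := B) Set.inter_subset_left
  unfold edgeTerm
  cases hd : τ.1.dir <;> rw [hd] at h
  · rw [h (m + 1) (min (r.order τ) m' + 1).toNat (by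
      ext e
      simp only [expBox, Set.mem_sdiff, Set.mem_inter_iff, Set.mem_ofPred_eq, Dir.normal]
      omega)]
    push_cast
    rw [Int.toNat_of_nonneg (by omega)]
  · rw [h (min (r.order τ) m + 1).toNat (m' + 1) (by
      ext e
      simp only [expBox, Set.mem_sdiff, Set.mem_inter_iff, Set.mem_ofPred_eq, Dir.normal]
      omega)]
    push_cast
    rw [Int.toNat_of_nonneg (by omega), mul_comm]

theorem edgeTerm_of_not_interior {τ : T.Edge} (h : ¬ T.IsInteriorEdge τ) :
    edgeTerm m m' r τ = 0 := by
  have h1 := r.boundary_eq τ h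
  unfold edgeTerm
  cases τ.1.dir <;> simp [h1]

/-- A vertex on the boundary does not contribute to the combinatorial formula, since one of the
edges at this vertex has order `-1`. -/
theorem vertexTerm_of_not_interior {γ : T.Vertex} (h : γ.1 ∉ interior T.domain) :
    (truncate (rh r γ) m + 1) * (truncate (rv r γ) m' + 1) = 0 := by
  obtain ⟨τ, hτ, hb⟩ := exists_boundary_edge γ h
  have h1 := r.boundary_eq τ hb
  have key : ∀ n, truncate (minOrder r τ.1.dir γ) n = -1 := by
    intro n
    refine le_antisymm ?_ (neg_one_le_truncate_minOrder _ _ _)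
    have h2 : minOrder r τ.1.dir γ ≤ ((-1 : ℤ) : WithTop ℤ) := by
      rw [← h1]
      exact Finset.inf_le (f := fun τ : T.Edge => (r.order τ : WithTop ℤ)) (by simp [hτ])
    unfold truncate
    cases hx : minOrder r τ.1.dir γ with
    | top => rw [hx] at h2; simp at h2
    | coe x =>
      rw [hx, WithTop.coe_le_coe] at h2
      simp only [WithTop.untopD_coe]
      omega
  cases hd : τ.1.dir <;> rw [hd] at key
  · simp [rv, key]
  · simp [rh, key]

theorem eulerChar_eq_combinatorialFormula (m m' : ℕ) (r : T.Smoothness) :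
    T.eulerChar m m' r = T.combinatorialFormula m m' r := by
  classical
  have h2 : (Module.finrank ℝ (T.Q₂ m m') : ℤ) = (T.faces.card : ℤ) * (m + 1) * (m' + 1) := by
    rw [Module.finrank_pi_fintype]
    simp [finrank_biDegree, mul_assoc]
  have h1 : (Module.finrank ℝ (T.Q₁ m m' r) : ℤ) = ∑ τ : T.Edge, edgeTerm m m' r τ := by
    have : ∀ τ : T.InteriorEdge, Module.Free ℝ (biDegree m m' ⧸
        (edgeIdeal m m' r τ.1).submoduleOf (biDegree m m')) := fun τ =>
      Module.Free.of_divisionRing ℝ _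
    rw [Module.finrank_pi_fintype]
    push_cast
    rw [← Finset.sum_subset (Finset.subset_univ (Finset.univ.filter T.IsInteriorEdge))]
    · rw [Finset.sum_subtype (Finset.univ.filter T.IsInteriorEdge) (p := T.IsInteriorEdge)
        (by simp)]
      exact Finset.sum_congr rfl fun τ _ => finrank_quotient_edgeIdeal τ.1
    · intro τ _ hτ
      exact edgeTerm_of_not_interior (by simpa using hτ)
  have h0 : (Module.finrank ℝ (T.Q₀ m m' r) : ℤ) =
      ∑ γ : T.Vertex, (truncate (rh r γ) m + 1) * (truncate (rv r γ) m' + 1) := by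
    have : ∀ γ : T.InteriorVertex, Module.Free ℝ (biDegree m m' ⧸
        (vertexIdeal m m' r γ.1).submoduleOf (biDegree m m')) := fun γ =>
      Module.Free.of_divisionRing ℝ _
    rw [Module.finrank_pi_fintype]
    push_cast
    rw [← Finset.sum_subset
      (Finset.subset_univ (Finset.univ.filter fun γ : T.Vertex => γ.1 ∈ interior T.domain))]
    · rw [Finset.sum_subtype (Finset.univ.filter fun γ : T.Vertex => γ.1 ∈ interior T.domain)
        (p := fun γ : T.Vertex => γ.1 ∈ interior T.domain) (by simp)]
      exact Finset.sum_congr rfl fun γ _ => finrank_quotient_vertexIdeal γ.1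
    · intro γ _ hγ
      exact vertexTerm_of_not_interior (by simpa using hγ)
  have h3 : ∑ τ : T.Edge, edgeTerm m m' r τ =
      (m + 1) * ∑ τ : T.Edge with τ.1.dir = Dir.horizontal, (min (r.order τ) (m' : ℤ) + 1) +
      (m' + 1) * ∑ τ : T.Edge with τ.1.dir = Dir.vertical, (min (r.order τ) (m : ℤ) + 1) := by
    rw [Finset.mul_sum, Finset.mul_sum, Finset.sum_filter, Finset.sum_filter,
      ← Finset.sum_add_distrib]
    refine Finset.sum_congr rfl fun τ _ => ?_
    unfold edgeTerm
    cases τ.1.dir <;> simp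
  unfold eulerChar combinatorialFormula
  rw [h2, h1, h0, h3]
  ring

theorem combinatorialFormula_congr {T' : TMesh} {r' : T'.Smoothness}
    (e : CombinatorialEquiv r r') (m m' : ℕ) :
    T'.combinatorialFormula m m' r' = T.combinatorialFormula m m' r := by
  classical
  have hcard : T'.faces.card = T.faces.card := by
    simpa using (Fintype.card_congr e.face).symm
  have hmin : ∀ d γ, minOrder r' d (e.vertex γ) = minOrder r d γ := by
    intro d γ
    unfold minOrder
    rw [← Finset.univ_map_equiv_to_embedding e.edge, Finset.filter_map, Finset.inf_map]
    refine Finset.inf_congr ?_ fun τ _ => by simp [e.order_eq]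
    ext τ
    simp [e.dir_eq, e.vertex_edge_iff]
  have hsum : ∀ (d : Dir) (n : ℕ),
      ∑ τ : T'.Edge with τ.1.dir = d, (min (r'.order τ) (n : ℤ) + 1) =
        ∑ τ : T.Edge with τ.1.dir = d, (min (r.order τ) (n : ℤ) + 1) := by
    intro d n
    rw [Finset.sum_filter, Finset.sum_filter, ← e.edge.sum_comp]
    simp [e.dir_eq, e.order_eq]
  unfold combinatorialFormula
  rw [hcard, hsum, hsum, ← e.vertex.sum_comp]
  simp only [rh, rv, hmin]

end TMesh

/-! ### Smoothness across an edge -/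

theorem hasDerivAt_max_pow (k : ℕ) (x : ℝ) :
    HasDerivAt (fun x : ℝ => max x 0 ^ (k + 2)) ((k + 2) * max x 0 ^ (k + 1)) x := by
  rcases lt_trichotomy x 0 with hx | rfl | hx
  · have h1 : (fun x : ℝ => max x 0 ^ (k + 2)) =ᶠ[nhds x] fun _ => 0 := by
      filter_upwards [gt_mem_nhds hx] with y hy
      simp [max_eq_right hy.le]
    rw [max_eq_right hx.le]
    simpa using (hasDerivAt_const x (0 : ℝ)).congr_of_eventuallyEq h1
  · have h : (fun y : ℝ => max y 0 ^ (k + 2)) =o[nhds 0] fun y => y := by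
      have h1 : (fun y : ℝ => max y 0 ^ (k + 2)) =O[nhds 0] fun y => y ^ (k + 2) := by
        refine Asymptotics.IsBigO.of_bound 1 (Filter.Eventually.of_forall fun y => ?_)
        rw [norm_pow, norm_pow, one_mul]
        refine pow_le_pow_left₀ (norm_nonneg _) ?_ _
        rcases le_total y 0 with h | h
        · simp [max_eq_right h]
        · simp [max_eq_left h]
      refine h1.trans_isLittleO ?_
      simpa using Asymptotics.isLittleO_pow_pow (𝕜 := ℝ) (m := 1) (n := k + 2) (by omega)
    rw [hasDerivAt_iff_isLittleO]
    simpa using h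
  · have h1 : (fun x : ℝ => max x 0 ^ (k + 2)) =ᶠ[nhds x] fun x => x ^ (k + 2) := by
      filter_upwards [lt_mem_nhds hx] with y hy
      simp [max_eq_left hy.le]
    rw [max_eq_left hx.le]
    have := (hasDerivAt_pow (k + 2) x).congr_of_eventuallyEq h1
    simpa using this

/-- Truncated powers are as smooth as they should be. -/
theorem contDiff_max_pow (k : ℕ) :
    ContDiff ℝ (k : WithTop ℕ∞) fun x : ℝ => max x 0 ^ (k + 1) := by
  induction k with
  | zero => exact contDiff_zero.2 (by fun_prop)
  | succ k ih =>
    push_cast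
    rw [contDiff_succ_iff_deriv]
    refine ⟨fun x => (hasDerivAt_max_pow k x).differentiableAt, by simp, ?_⟩
    have : deriv (fun x : ℝ => max x 0 ^ (k + 1 + 1)) = fun x : ℝ => (k + 2) * max x 0 ^ (k + 1) :=
      funext fun x => (hasDerivAt_max_pow k x).deriv
    rw [this]
    exact contDiff_const.mul ih

theorem Poly₂.aeval_eq_evalAt (p : Poly₂) (x : ℝ × ℝ) :
    aeval ![x.1, x.2] p = p.evalAt x :=
  DFunLike.congr_fun (coe_aeval_eq_eval ![x.1, x.2]) p

theorem Poly₂.contDiff_evalAt (p : Poly₂) {n : WithTop ℕ∞} : ContDiff ℝ n p.evalAt := by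
  unfold Poly₂.evalAt
  induction p using MvPolynomial.induction_on with
  | C a => simpa using contDiff_const
  | add p q hp hq => simpa using hp.add hq
  | mul_X p i hp =>
    simp only [map_mul, eval_X]
    refine hp.mul ?_
    fin_cases i
    · exact contDiff_fst
    · exact contDiff_snd

/-- A polynomial that extends zero as a function of class `C ^ k` across the point `c` vanishes
there of order greater than `k`. -/
theorem Polynomial.pow_dvd_of_contDiffOn {c δ : ℝ} (hδ : 0 < δ) (k : ℕ) {φ : ℝ → ℝ}
    {P : Polynomial ℝ} (hφ : ContDiffOn ℝ (k : WithTop ℕ∞) φ (Set.Ioo (c - δ) (c + δ)))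
    (h0 : ∀ y ∈ Set.Ioo (c - δ) c, φ y = 0) (hP : ∀ y ∈ Set.Ioo c (c + δ), φ y = P.eval y) :
    (Polynomial.X - Polynomial.C c) ^ (k + 1) ∣ P := by
  have hroot : P.IsRoot c := by
    have hc : ContinuousAt φ c := hφ.continuousOn.continuousAt
      (Ioo_mem_nhds (by linarith) (by linarith))
    have hl : Filter.Tendsto φ (nhdsWithin c (Set.Iio c)) (nhds 0) := by
      refine tendsto_const_nhds.congr' ?_
      filter_upwards [Ioo_mem_nhdsLT (show c - δ < c by linarith)] with y hy
      exact (h0 y hy).symm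
    have hr : Filter.Tendsto φ (nhdsWithin c (Set.Ioi c)) (nhds (P.eval c)) := by
      refine ((P.continuous.tendsto c).mono_left nhdsWithin_le_nhds).congr' ?_
      filter_upwards [Ioo_mem_nhdsGT (show c < c + δ by linarith)] with y hy
      exact (hP y hy).symm
    have h1 := tendsto_nhds_unique hl (hc.tendsto.mono_left nhdsWithin_le_nhds)
    have h2 := tendsto_nhds_unique hr (hc.tendsto.mono_left nhdsWithin_le_nhds)
    exact h2.trans h1.symm
  induction k generalizing φ P with
  | zero => simpa using Polynomial.dvd_iff_isRoot.2 hroot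
  | succ k ih =>
    push_cast at hφ
    rw [contDiffOn_succ_iff_deriv_of_isOpen isOpen_Ioo] at hφ
    by_cases hP0 : P = 0
    · simp [hP0]
    have h0' : ∀ y ∈ Set.Ioo (c - δ) c, deriv φ y = 0 := by
      intro y hy
      have : φ =ᶠ[nhds y] fun _ => 0 := by
        filter_upwards [Ioo_mem_nhds hy.1 hy.2] with z hz
        exact h0 z hz
      rw [this.deriv_eq, deriv_const]
    have hP' : ∀ y ∈ Set.Ioo c (c + δ), deriv φ y = P.derivative.eval y := by
      intro y hy
      have : φ =ᶠ[nhds y] fun y => P.eval y := by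
        filter_upwards [Ioo_mem_nhds hy.1 hy.2] with z hz
        exact hP z hz
      rw [this.deriv_eq, Polynomial.deriv]
    have hroot' : P.derivative.IsRoot c := by
      have hc : ContinuousAt (deriv φ) c := hφ.2.2.continuousOn.continuousAt
        (Ioo_mem_nhds (by linarith) (by linarith))
      have hl : Filter.Tendsto (deriv φ) (nhdsWithin c (Set.Iio c)) (nhds 0) := by
        refine tendsto_const_nhds.congr' ?_
        filter_upwards [Ioo_mem_nhdsLT (show c - δ < c by linarith)] with y hy
        exact (h0' y hy).symm
      have hr : Filter.Tendsto (deriv φ) (nhdsWithin c (Set.Ioi c))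
          (nhds (P.derivative.eval c)) := by
        refine ((P.derivative.continuous.tendsto c).mono_left nhdsWithin_le_nhds).congr' ?_
        filter_upwards [Ioo_mem_nhdsGT (show c < c + δ by linarith)] with y hy
        exact (hP' y hy).symm
      have h1 := tendsto_nhds_unique hl (hc.tendsto.mono_left nhdsWithin_le_nhds)
      have h2 := tendsto_nhds_unique hr (hc.tendsto.mono_left nhdsWithin_le_nhds)
      exact h2.trans h1.symm
    have h1 := ih hφ.2.2 h0' hP' hroot'
    have hd0 : P.derivative ≠ 0 := by
      intro h
      rw [Polynomial.eq_C_of_derivative_eq_zero h] at hroot hP0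
      simp only [Polynomial.IsRoot, Polynomial.eval_C] at hroot
      rw [hroot] at hP0
      simp at hP0
    rw [← Polynomial.le_rootMultiplicity_iff hd0,
      Polynomial.derivative_rootMultiplicity_of_root hroot] at h1
    rw [← Polynomial.le_rootMultiplicity_iff hP0]
    omega

/-- The restriction of a polynomial to the line perpendicular to the direction `d` through the
points with coordinate `t` in this direction. -/
noncomputable def restrictLine (d : Dir) (t : ℝ) : Poly₂ →ₐ[ℝ] Polynomial ℝ :=
  aeval fun i => if i = d.normal then Polynomial.X else Polynomial.C t

theorem eval_restrictLine (d : Dir) (t y : ℝ) (p : Poly₂) :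
    (restrictLine d t p).eval y = p.evalAt (d.mk t y) := by
  have h : ((Polynomial.aeval y).comp (restrictLine d t) : Poly₂ →ₐ[ℝ] ℝ) =
      aeval ![(d.mk t y).1, (d.mk t y).2] := by
    refine algHom_ext fun i => ?_
    cases d <;> fin_cases i <;> simp [restrictLine, Dir.normal, Dir.mk]
  have h1 := DFunLike.congr_fun h p
  rw [AlgHom.comp_apply, Polynomial.coe_aeval_eq_eval, Poly₂.aeval_eq_evalAt] at h1
  exact h1

/-- A polynomial that vanishes on a segment is divisible by its linear form. -/
theorem linearForm_dvd_of_forall {τ : Seg} {p : Poly₂}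
    (h : ∀ t ∈ Set.Ioo τ.a τ.b, p.evalAt (τ.dir.mk t τ.c) = 0) : τ.linearForm ∣ p := by
  set f : Poly₂ →ₐ[ℝ] Poly₂ := aeval fun i => if i = τ.dir.normal then C τ.c else X i with hf
  have h1 : τ.linearForm ∣ p - f p := by
    rw [← Ideal.mem_span_singleton, ← Ideal.Quotient.mk_eq_mk_iff_sub_mem]
    have : (Ideal.Quotient.mkₐ ℝ (Ideal.span {τ.linearForm})) =
        (Ideal.Quotient.mkₐ ℝ (Ideal.span {τ.linearForm})).comp f := by
      refine algHom_ext fun i => ?_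
      simp only [hf, AlgHom.comp_apply, aeval_X]
      split_ifs with hi
      · rw [Ideal.Quotient.mkₐ_eq_mk, Ideal.Quotient.mk_eq_mk_iff_sub_mem,
          Ideal.mem_span_singleton, τ.linearForm_eq, hi]
      · rfl
    exact DFunLike.congr_fun this p
  have h2 : f p = 0 := by
    refine funext_set (fun _ => Set.Ioo τ.a τ.b) (fun _ => Set.Ioo_infinite τ.lt) fun x hx => ?_
    rw [map_zero]
    have h3 : ((aeval x).comp f : Poly₂ →ₐ[ℝ] ℝ) =
        aeval ![(τ.dir.mk (x τ.dir.flip.normal) τ.c).1,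
          (τ.dir.mk (x τ.dir.flip.normal) τ.c).2] := by
      refine algHom_ext fun i => ?_
      rw [AlgHom.comp_apply, hf, aeval_X]
      generalize τ.dir = d
      cases d <;> fin_cases i <;> simp [Dir.normal, Dir.mk, Dir.flip]
    have h4 := DFunLike.congr_fun h3 p
    rw [AlgHom.comp_apply, Poly₂.aeval_eq_evalAt] at h4
    exact (DFunLike.congr_fun (coe_aeval_eq_eval x) (f p)).symm.trans
      (h4.trans (h _ (hx _ (Set.mem_univ _))))
  rwa [h2, sub_zero] at h1

theorem restrictLine_linearForm (τ : Seg) (t : ℝ) :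
    restrictLine τ.dir t τ.linearForm = Polynomial.X - Polynomial.C τ.c := by
  rw [τ.linearForm_eq, map_sub]
  simp [restrictLine, Polynomial.algebraMap_eq]

theorem linearForm_pow_dvd_of_forall {τ : Seg} {k : ℕ} {p : Poly₂}
    (h : ∀ t ∈ Set.Ioo τ.a τ.b, (Polynomial.X - Polynomial.C τ.c) ^ k ∣ restrictLine τ.dir t p) :
    τ.linearForm ^ k ∣ p := by
  induction k generalizing p with
  | zero => simp
  | succ k ih =>
    obtain ⟨q, rfl⟩ : τ.linearForm ∣ p := linearForm_dvd_of_forall fun t ht => by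
      rw [← eval_restrictLine]
      exact Polynomial.dvd_iff_isRoot.1 ((dvd_pow_self _ k.succ_ne_zero).trans (h t ht))
    rw [pow_succ']
    refine mul_dvd_mul_left _ (ih fun t ht => ?_)
    have h1 := h t ht
    rw [map_mul, restrictLine_linearForm, pow_succ'] at h1
    exact (mul_dvd_mul_iff_left (Polynomial.X_sub_C_ne_zero _)).1 h1

theorem Poly₂.evalAt_linearForm (τ : Seg) (x : ℝ × ℝ) :
    Poly₂.evalAt τ.linearForm x = τ.dir.flip.coord x - τ.c := by
  rw [τ.linearForm_eq]
  cases τ.dir <;> simp [Poly₂.evalAt, Dir.normal, Dir.flip, Dir.coord]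

theorem Dir.contDiff_coord (d : Dir) {n : WithTop ℕ∞} : ContDiff ℝ n d.coord := by
  cases d
  · exact contDiff_fst
  · exact contDiff_snd

theorem Dir.contDiff_mk (d : Dir) (t : ℝ) {n : WithTop ℕ∞} : ContDiff ℝ n (d.mk t) := by
  cases d
  · exact contDiff_const.prodMk contDiff_id
  · exact contDiff_id.prodMk contDiff_const

namespace TMesh

variable {T : TMesh}

/-- Close to the relative interior of an interior edge the positive side is contained in the face
on the positive side, and likewise for the negative side. -/
theorem mem_sideFace_cell (τ : T.InteriorEdge) {x : ℝ × ℝ}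
    (hx : τ.1.1.a < τ.1.1.dir.coord x ∧ τ.1.1.dir.coord x < τ.1.1.b) :
    (τ.1.1.c < τ.1.1.dir.flip.coord x →
      τ.1.1.dir.flip.coord x < (sideFace τ true).1.hi τ.1.1.dir.flip →
      x ∈ (sideFace τ true).1.cell) ∧
    (τ.1.1.dir.flip.coord x < τ.1.1.c →
      (sideFace τ false).1.lo τ.1.1.dir.flip < τ.1.1.dir.flip.coord x →
      x ∈ (sideFace τ false).1.cell) := by
  have h1 := sideFace_borders τ true
  have h2 := sideFace_borders τ false
  have e1 := h1.2.2
  have e2 := h2.2.2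
  simp only [if_true, Bool.false_eq_true, if_false] at e1 e2
  refine ⟨fun h h' => (Rect.mem_cell τ.1.1.dir).2 ⟨⟨h1.1.trans_lt hx.1, hx.2.trans_le h1.2.1⟩,
    e1 ▸ h, h'⟩, fun h h' => (Rect.mem_cell τ.1.1.dir).2
      ⟨⟨h2.1.trans_lt hx.1, hx.2.trans_le h2.2.1⟩, h', e2 ▸ h⟩⟩

/-- A piecewise polynomial function is of class `C ^ k` across an interior edge if and only if the
difference of the polynomials on both sides is divisible by the power of order `k + 1` of the linear
form of the edge. -/
theorem smoothAcross_iff {f : T.openFaces → ℝ} {p : T.Face → Poly₂}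
    (hf : ∀ (σ : T.Face) (x : T.openFaces), (x : ℝ × ℝ) ∈ σ.1.cell → f x = (p σ).evalAt x)
    (τ : T.InteriorEdge) (k : ℕ) :
    T.SmoothAcross k τ.1.1 f ↔ τ.1.1.linearForm ^ (k + 1) ∣ jump p τ := by
  set d := τ.1.1.dir with hd
  have hup := sideFace_borders τ true
  have hdown := sideFace_borders τ false
  have e1 := hup.2.2
  have e2 := hdown.2.2
  simp only [if_true, Bool.false_eq_true, if_false] at e1 e2
  have hlt1 := (sideFace τ true).1.lo_lt_hi d.flip
  have hlt2 := (sideFace τ false).1.lo_lt_hi d.flip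
  rw [← hd] at e1 e2
  rw [← e1] at hlt1
  rw [← e2] at hlt2
  have hmemO : ∀ (σ : T.Face) x, x ∈ σ.1.cell → x ∈ T.openFaces := fun σ x hx =>
    Set.mem_biUnion σ.2 hx
  constructor
  · rintro ⟨U, g, hU, hτU, hg, hfg⟩
    refine linearForm_pow_dvd_of_forall fun t ht => ?_
    have hmem : d.mk t τ.1.1.c ∈ U := hτU (Seg.mem_relInterior.2 (by simp [← hd, ht.1, ht.2]))
    have hcont : Continuous (d.mk t) := d.continuous_mk continuous_const continuous_id
    have hV : d.mk t ⁻¹' U ∩ Set.Ioo ((sideFace τ false).1.lo d.flip)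
        ((sideFace τ true).1.hi d.flip) ∈ nhds τ.1.1.c :=
      Filter.inter_mem ((hU.preimage hcont).mem_nhds hmem) (Ioo_mem_nhds hlt2 hlt1)
    obtain ⟨δ, hδ, hsub⟩ := Metric.mem_nhds_iff.1 hV
    rw [Real.ball_eq_Ioo] at hsub
    refine Polynomial.pow_dvd_of_contDiffOn hδ k
      (φ := fun y => g (d.mk t y) - (p (sideFace τ false)).evalAt (d.mk t y)) ?_ ?_ ?_
    · refine ContDiffOn.sub ?_ ?_
      · exact hg.comp (d.contDiff_mk t).contDiffOn fun y hy => (hsub hy).1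
      · exact (((p (sideFace τ false)).contDiff_evalAt).comp (d.contDiff_mk t)).contDiffOn
    · intro y hy
      have hy' := hsub (show y ∈ Set.Ioo _ _ from ⟨hy.1, by linarith [hy.2]⟩)
      have hc := (mem_sideFace_cell τ (x := d.mk t y) (by simpa [← hd] using ht)).2
        (by simpa [← hd] using hy.2) (by simpa [← hd] using hy'.2.1)
      change g (d.mk t y) - _ = 0
      rw [← hfg ⟨_, hmemO _ _ hc⟩ hy'.1, hf _ ⟨_, hmemO _ _ hc⟩ hc, sub_self]
    · intro y hy
      have hy' := hsub (show y ∈ Set.Ioo _ _ from ⟨by linarith [hy.1], hy.2⟩)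
      have hc := (mem_sideFace_cell τ (x := d.mk t y) (by simpa [← hd] using ht)).1
        (by simpa [← hd] using hy.1) (by simpa [← hd] using hy'.2.2)
      change g (d.mk t y) - _ = _
      rw [← hfg ⟨_, hmemO _ _ hc⟩ hy'.1, hf _ ⟨_, hmemO _ _ hc⟩ hc, eval_restrictLine, jump]
      simp [Poly₂.evalAt, ← hd]
  · rintro ⟨q, hq⟩
    refine ⟨{x | (τ.1.1.a < d.coord x ∧ d.coord x < τ.1.1.b) ∧
        ((sideFace τ false).1.lo d.flip < d.flip.coord x ∧
          d.flip.coord x < (sideFace τ true).1.hi d.flip)},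
      fun x => (p (sideFace τ false)).evalAt x +
        max (d.flip.coord x - τ.1.1.c) 0 ^ (k + 1) * q.evalAt x, ?_, ?_, ?_, ?_⟩
    · have h1 := d.continuous_coord
      have h2 := d.flip.continuous_coord
      exact ((isOpen_lt continuous_const h1).inter (isOpen_lt h1 continuous_const)).inter
        ((isOpen_lt continuous_const h2).inter (isOpen_lt h2 continuous_const))
    · intro x hx
      obtain ⟨h1, h2⟩ := Seg.mem_relInterior.1 hx
      rw [← hd] at h1 h2
      exact ⟨h1, by rw [h2]; exact ⟨hlt2, hlt1⟩⟩
    · refine ContDiff.contDiffOn (Poly₂.contDiff_evalAt _ |>.add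
        (((contDiff_max_pow k).comp (d.flip.contDiff_coord.sub contDiff_const)).mul
          (Poly₂.contDiff_evalAt _)))
    · rintro x ⟨hx1, hx2⟩
      obtain ⟨σ, hσ, hxσ⟩ : ∃ σ ∈ T.faces, (x : ℝ × ℝ) ∈ σ.cell := by
        have := x.2
        simpa [openFaces] using this
      have hjump : (p (sideFace τ true)).evalAt x - (p (sideFace τ false)).evalAt x =
          (d.flip.coord (x : ℝ × ℝ) - τ.1.1.c) ^ (k + 1) * q.evalAt x := by
        have h := congrArg (fun p : Poly₂ => p.evalAt x) hq
        have e := Poly₂.evalAt_linearForm τ.1.1 x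
        rw [← hd] at e
        rw [← e]
        simpa [Poly₂.evalAt, jump] using h
      obtain ⟨hc1, hc2⟩ := mem_sideFace_cell τ (x := x) hx1
      rcases lt_trichotomy (d.flip.coord (x : ℝ × ℝ)) τ.1.1.c with h | h | h
      · beta_reduce
        rw [hf _ x (hc2 h hx2.1), max_eq_right (by linarith)]
        simp
      · exact absurd hxσ (notMem_cell_of_mem_edge τ.1.2 hσ
          (Seg.mem_carrier.2 ⟨⟨hx1.1.le, hx1.2.le⟩, h⟩))
      · beta_reduce
        rw [hf _ x (hc1 h hx2.2), max_eq_left (by linarith), ← hjump]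
        ring

end TMesh

/-! ### Dimension counts -/

theorem Submodule.finrank_eq_map_add_inf_ker {K M N : Type*} [Field K] [AddCommGroup M]
    [Module K M] [AddCommGroup N] [Module K N] (D : M →ₗ[K] N) (W : Submodule K M)
    [Module.Finite K W] :
    Module.finrank K W =
      Module.finrank K (W.map D) + Module.finrank K (W ⊓ LinearMap.ker D : Submodule K M) := by
  have h1 := (D.domRestrict W).finrank_range_add_finrank_ker
  have h2 : LinearMap.range (D.domRestrict W) = W.map D := by
    ext x
    simp [LinearMap.domRestrict]
  have h3 : (LinearMap.ker (D.domRestrict W)).map W.subtype = W ⊓ LinearMap.ker D := by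
    ext x
    simp [LinearMap.domRestrict, and_comm]
  rw [h2, ← Submodule.finrank_map_subtype_eq W, h3] at h1
  exact h1.symm

/-- The dimension count behind the theorem. For an exact sequence `A → P₁ → P₀ → 0` and a subspace
`J₁` of `P₁`, it computes the dimension of the kernel of `A → P₁ / J₁`. -/
theorem Submodule.finrank_comap_add {K A M N : Type*} [Field K] [AddCommGroup A] [Module K A]
    [Module.Finite K A] [AddCommGroup M] [Module K M] [AddCommGroup N] [Module K N]
    (D₂ : A →ₗ[K] M) (D : M →ₗ[K] N) {P₁ J₁ : Submodule K M} {P₀ : Submodule K N}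
    [Module.Finite K P₁] (hJ : J₁ ≤ P₁) (hsurj : P₁.map D = P₀)
    (hexact : LinearMap.range D₂ = P₁ ⊓ LinearMap.ker D) :
    Module.finrank K (J₁.comap D₂) + Module.finrank K P₁ + Module.finrank K (J₁.map D) =
      Module.finrank K A + Module.finrank K P₀ + Module.finrank K J₁ := by
  have : Module.Finite K J₁ := Submodule.finiteDimensional_of_le hJ
  have h1 := Submodule.finrank_eq_map_add_inf_ker D P₁
  have h2 := Submodule.finrank_eq_map_add_inf_ker D J₁
  have h3 := Submodule.finrank_eq_map_add_inf_ker D₂ (J₁.comap D₂)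
  have h4 := D₂.finrank_range_add_finrank_ker
  rw [Submodule.map_comap_eq, hexact, inf_eq_right.2 (LinearMap.ker_le_comap D₂),
    show P₁ ⊓ LinearMap.ker D ⊓ J₁ = J₁ ⊓ LinearMap.ker D by
      rw [inf_right_comm, inf_eq_right.2 hJ]] at h3
  rw [hsurj] at h1
  rw [hexact] at h4
  omega

/-- The product of submodules, as a submodule of the product, is the product of the submodules. -/
def Submodule.piUnivEquiv {K ι : Type*} {M : ι → Type*} [Semiring K]
    [∀ i, AddCommMonoid (M i)] [∀ i, Module K (M i)] (J : ∀ i, Submodule K (M i)) :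
    Submodule.pi Set.univ J ≃ₗ[K] ((i : ι) → J i) where
  toFun x i := ⟨x.1 i, x.2 i (Set.mem_univ i)⟩
  map_add' _ _ := rfl
  map_smul' _ _ := rfl
  invFun y := ⟨fun i => y i, fun i _ => (y i).2⟩
  left_inv _ := rfl
  right_inv _ := rfl

theorem Submodule.finite_pi_univ {K ι : Type*} {M : Type*} [Field K] [Finite ι]
    [AddCommGroup M] [Module K M] (P : Submodule K M) [Module.Finite K P] :
    Module.Finite K (Submodule.pi Set.univ fun _ : ι => P) :=
  Module.Finite.equiv (Submodule.piUnivEquiv fun _ : ι => P).symm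

theorem Submodule.finrank_pi_quotient_add {K ι : Type*} {M : Type*} [Field K] [Fintype ι]
    [AddCommGroup M] [Module K M] (P : Submodule K M) [Module.Finite K P] (J : ι → Submodule K M)
    (hJ : ∀ i, J i ≤ P) :
    Module.finrank K ((i : ι) → P ⧸ (J i).submoduleOf P) +
      Module.finrank K (Submodule.pi Set.univ J) =
      Module.finrank K (Submodule.pi Set.univ fun _ : ι => P) := by
  have h0 : ∀ i, Module.Free K (P ⧸ (J i).submoduleOf P) := fun i =>
    Module.Free.of_divisionRing K _
  have h1 : ∀ i, Module.Finite K (J i) := fun i => Submodule.finiteDimensional_of_le (hJ i)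
  rw [(Submodule.piUnivEquiv J).finrank_eq, (Submodule.piUnivEquiv fun _ : ι => P).finrank_eq,
    Module.finrank_pi_fintype, Module.finrank_pi_fintype, Module.finrank_pi_fintype,
    ← Finset.sum_add_distrib]
  refine Finset.sum_congr rfl fun i _ => ?_
  rw [← ((J i).submoduleOf P).finrank_quotient_add_finrank,
    (Submodule.submoduleOfEquivOfLe (hJ i)).finrank_eq]

namespace TMesh

variable {T : TMesh} {m m' : ℕ} {r : T.Smoothness}

theorem boundaryMap_apply (z : T.InteriorEdge → Poly₂) : T.boundaryMap z = edgeBoundary z := by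
  funext γ
  simp only [boundaryMap, LinearMap.pi_apply, LinearMap.sum_apply, LinearMap.smul_apply,
    LinearMap.proj_apply, edgeBoundary, incidence_eq, Int.cast_smul_eq_zsmul]

/-- The cellular boundary map from chains of faces to chains of interior edges. -/
noncomputable def faceBoundary (T : TMesh) (m m' : ℕ) :
    (T.Face → biDegree m m') →ₗ[ℝ] (T.InteriorEdge → Poly₂) where
  toFun u τ := Dir.sign τ.1.1.dir • jump (fun σ => (u σ : Poly₂)) τ
  map_add' u v := by
    funext τ
    simp only [jump, Pi.add_apply, Submodule.coe_add, ← smul_add]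
    congr 1
    abel
  map_smul' c u := by
    funext τ
    simp only [jump, Pi.smul_apply, Submodule.coe_smul, RingHom.id_apply, ← smul_sub]
    rw [smul_comm]

theorem sign_smul_mem {V : Submodule ℝ Poly₂} (d : Dir) {p : Poly₂} :
    Dir.sign d • p ∈ V ↔ p ∈ V := by
  cases d <;> simp [Dir.sign]

theorem jump_mem_biDegree (u : T.Face → biDegree m m') (τ : T.InteriorEdge) :
    jump (fun σ => (u σ : Poly₂)) τ ∈ biDegree m m' :=
  sub_mem (u _).2 (u _).2

/-- Exactness of the constant complex at the edges. -/
theorem range_faceBoundary (hT : T.IsSimplyConnected) :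
    LinearMap.range (T.faceBoundary m m') =
      Submodule.pi Set.univ (fun _ : T.InteriorEdge => biDegree m m') ⊓
        LinearMap.ker T.boundaryMap := by
  ext z
  constructor
  · rintro ⟨u, rfl⟩
    refine ⟨fun τ _ => (sign_smul_mem _).2 (jump_mem_biDegree u τ), ?_⟩
    rw [SetLike.mem_coe, LinearMap.mem_ker, boundaryMap_apply]
    exact funext fun γ => edgeBoundary_jump _ γ
  · rintro ⟨h1, h2⟩
    rw [SetLike.mem_coe, LinearMap.mem_ker, boundaryMap_apply] at h2
    obtain ⟨u, hu⟩ := exists_primitive hT (V := biDegree m m')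
      (fun τ => Dir.sign τ.1.1.dir • ⟨z τ, h1 τ (Set.mem_univ τ)⟩) (fun γ => by
        refine Subtype.ext ?_
        have h3 := map_edgeBoundary (T := T) (biDegree m m').subtype.toAddMonoidHom
          (fun τ => Dir.sign τ.1.1.dir • Dir.sign τ.1.1.dir •
            (⟨z τ, h1 τ (Set.mem_univ τ)⟩ : biDegree m m')) γ
        refine h3.symm.trans (Eq.trans ?_ (congrFun h2 γ))
        congr 1
        funext τ
        rw [smul_smul, Dir.sign_mul_self, one_smul]
        rfl)
    refine ⟨u, funext fun τ => ?_⟩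
    have h4 := congrArg Subtype.val (congrFun hu τ)
    change Dir.sign τ.1.1.dir • jump (fun σ => (u σ : Poly₂)) τ = z τ
    have h5 : jump (fun σ => (u σ : Poly₂)) τ = Dir.sign τ.1.1.dir • z τ := by
      simpa [jump] using h4
    rw [h5, smul_smul, Dir.sign_mul_self, one_smul]

/-- Exactness of the constant complex at the vertices. -/
theorem map_boundaryMap :
    (Submodule.pi Set.univ fun _ : T.InteriorEdge => biDegree m m').map T.boundaryMap =
      Submodule.pi Set.univ fun _ : T.InteriorVertex => biDegree m m' := by
  refine le_antisymm ?_ fun w hw => ?_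
  · rintro _ ⟨z, hz, rfl⟩ γ _
    rw [boundaryMap_apply]
    exact Submodule.sum_mem _ fun τ _ => zsmul_mem (hz τ (Set.mem_univ τ)) _
  · obtain ⟨z, hz⟩ := exists_edgeBoundary_eq (T := T)
      fun γ => (⟨w γ, hw γ (Set.mem_univ γ)⟩ : biDegree m m')
    refine ⟨fun τ => z τ, fun τ _ => (z τ).2, ?_⟩
    rw [boundaryMap_apply]
    funext γ
    have h := map_edgeBoundary (T := T) (biDegree m m').subtype.toAddMonoidHom z γ
    rw [hz] at h
    exact h

/-! ### Splines as cycles -/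

theorem exists_mem_cell (x : T.openFaces) : ∃ σ : T.Face, (x : ℝ × ℝ) ∈ σ.1.cell := by
  have := x.2
  simp only [openFaces, Set.mem_iUnion] at this
  obtain ⟨σ, hσ, h⟩ := this
  exact ⟨⟨σ, hσ⟩, h⟩

/-- The face that contains a given point. -/
noncomputable def faceOf (x : T.openFaces) : T.Face := (exists_mem_cell x).choose

theorem mem_faceOf (x : T.openFaces) : (x : ℝ × ℝ) ∈ (faceOf x).1.cell :=
  (exists_mem_cell x).choose_spec

theorem eq_faceOf {x : T.openFaces} {σ : T.Face} (h : (x : ℝ × ℝ) ∈ σ.1.cell) : σ = faceOf x :=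
  Subtype.ext (eq_of_mem_cell σ.2 (faceOf x).2 h (subset_closure (mem_faceOf x)))

/-- The piecewise polynomial function with given polynomials on the faces. -/
noncomputable def piecewise (T : TMesh) (m m' : ℕ) :
    (T.Face → biDegree m m') →ₗ[ℝ] (T.openFaces → ℝ) where
  toFun u x := Poly₂.evalAt (u (faceOf x)) x
  map_add' u v := by
    funext x
    simp [Poly₂.evalAt]
  map_smul' c u := by
    funext x
    simp [Poly₂.evalAt, smul_eval]

theorem piecewise_apply (u : T.Face → biDegree m m') (σ : T.Face) (x : T.openFaces)
    (hx : (x : ℝ × ℝ) ∈ σ.1.cell) : T.piecewise m m' u x = Poly₂.evalAt (u σ) x := by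
  rw [eq_faceOf hx]
  rfl

theorem _root_.Poly₂.eq_of_eqOn_cell {p q : Poly₂} {σ : Rect}
    (h : ∀ x ∈ σ.cell, p.evalAt x = q.evalAt x) : p = q := by
  refine funext_set ![Set.Ioo σ.x₀ σ.x₁, Set.Ioo σ.y₀ σ.y₁] (fun i => ?_) fun x hx => ?_
  · fin_cases i
    · exact Set.Ioo_infinite σ.x_lt
    · exact Set.Ioo_infinite σ.y_lt
  · have h1 := h (x 0, x 1) ⟨hx 0 (Set.mem_univ _), hx 1 (Set.mem_univ _)⟩
    have h2 : ![x 0, x 1] = x := by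
      funext i
      fin_cases i <;> rfl
    unfold Poly₂.evalAt at h1
    rwa [h2] at h1

theorem piecewise_injective : Function.Injective (T.piecewise m m') := by
  intro u v h
  funext σ
  refine Subtype.ext (Poly₂.eq_of_eqOn_cell (σ := σ.1) fun x hx => ?_)
  have hx' : x ∈ T.openFaces := Set.mem_biUnion σ.2 hx
  rw [← piecewise_apply u σ ⟨x, hx'⟩ hx, ← piecewise_apply v σ ⟨x, hx'⟩ hx, h]

theorem mem_edgeIdeal_iff {u : T.Face → biDegree m m'} {τ : T.InteriorEdge} :
    jump (fun σ => (u σ : Poly₂)) τ ∈ edgeIdeal m m' r τ.1 ↔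
      (0 ≤ r.order τ.1 → T.SmoothAcross (r.order τ.1).toNat τ.1.1 (T.piecewise m m' u)) := by
  have h0 := r.neg_one_le τ.1
  rw [smoothAcross_iff (p := fun σ => (u σ : Poly₂)) (fun σ x hx => piecewise_apply u σ x hx) τ,
    edgeIdeal, Submodule.mem_inf, Submodule.restrictScalars_mem, Ideal.mem_span_singleton]
  rw [and_iff_right (jump_mem_biDegree u τ)]
  by_cases h : 0 ≤ r.order τ.1
  · rw [show (r.order τ.1 + 1).toNat = (r.order τ.1).toNat + 1 by omega]
    exact ⟨fun h1 _ => h1, fun h1 => h1 h⟩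
  · rw [show (r.order τ.1 + 1).toNat = 0 by omega]
    simp [h]

/-- The spline space consists of the piecewise polynomial functions whose jumps across the interior
edges lie in the spaces `J_τ`. -/
theorem map_piecewise_comap :
    ((T.idealChain₁ m m' r).comap (T.faceBoundary m m')).map (T.piecewise m m') =
      T.splineSpace m m' r := by
  have hmem : ∀ u, u ∈ (T.idealChain₁ m m' r).comap (T.faceBoundary m m') ↔
      ∀ τ : T.InteriorEdge, jump (fun σ => (u σ : Poly₂)) τ ∈ edgeIdeal m m' r τ.1 := by
    intro u
    constructor
    · exact fun h τ => (sign_smul_mem _).1 (h τ (Set.mem_univ τ))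
    · exact fun h τ _ => (sign_smul_mem _).2 (h τ)
  ext f
  constructor
  · rintro ⟨u, hu, rfl⟩
    exact ⟨fun σ hσ => ⟨u ⟨σ, hσ⟩, (u ⟨σ, hσ⟩).2, fun x hx => piecewise_apply u ⟨σ, hσ⟩ x hx⟩,
      fun τ hτ => mem_edgeIdeal_iff.1 ((hmem u).1 hu ⟨τ, hτ⟩)⟩
  · rintro ⟨h1, h2⟩
    choose p hp hpf using h1
    let u : T.Face → biDegree m m' := fun σ => ⟨p σ.1 σ.2, hp σ.1 σ.2⟩
    have hf : T.piecewise m m' u = f := by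
      funext x
      rw [piecewise_apply u (faceOf x) x (mem_faceOf x)]
      exact (hpf (faceOf x).1 (faceOf x).2 x (mem_faceOf x)).symm
    refine ⟨u, (hmem u).2 fun τ => ?_, hf⟩
    rw [mem_edgeIdeal_iff, hf]
    exact h2 τ.1 τ.2

theorem finite_splineSpace : Module.Finite ℝ (T.splineSpace m m' r) := by
  rw [← map_piecewise_comap]
  exact Module.Finite.map _ _

theorem finite_idealChain₀ : Module.Finite ℝ (T.idealChain₀ m m' r) := by
  have := Submodule.finite_pi_univ (ι := T.InteriorVertex) (biDegree m m')
  exact Submodule.finiteDimensional_of_le (Submodule.pi_mono fun γ _ => vertexIdeal_le γ.1)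

theorem finrank_idealH₀_add :
    Module.finrank ℝ (T.IdealH₀ m m' r) +
      Module.finrank ℝ ((T.idealChain₁ m m' r).map T.boundaryMap) =
      Module.finrank ℝ (T.idealChain₀ m m' r) := by
  have := finite_idealChain₀ (T := T) (m := m) (m' := m') (r := r)
  have h : (LinearMap.range (T.idealBoundary m m' r)).map (T.idealChain₀ m m' r).subtype =
      (T.idealChain₁ m m' r).map T.boundaryMap := by
    ext w
    constructor
    · rintro ⟨_, ⟨z, rfl⟩, rfl⟩
      exact ⟨z.1, z.2, rfl⟩
    · rintro ⟨z, hz, rfl⟩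
      exact ⟨T.idealBoundary m m' r ⟨z, hz⟩, ⟨_, rfl⟩, rfl⟩
  rw [← (LinearMap.range (T.idealBoundary m m' r)).finrank_quotient_add_finrank, ← h,
    Submodule.finrank_map_subtype_eq]

theorem finrank_splineSpace (hT : T.IsSimplyConnected) :
    (Module.finrank ℝ (T.splineSpace m m' r) : ℤ) =
      T.eulerChar m m' r + Module.finrank ℝ (T.IdealH₀ m m' r) := by
  have := Submodule.finite_pi_univ (ι := T.InteriorEdge) (biDegree m m')
  have h1 := Submodule.finrank_comap_add (T.faceBoundary m m') T.boundaryMap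
    (J₁ := T.idealChain₁ m m' r) (Submodule.pi_mono fun τ _ => edgeIdeal_le τ.1)
    map_boundaryMap (range_faceBoundary hT)
  rw [(Submodule.equivMapOfInjective _ piecewise_injective _).finrank_eq,
    map_piecewise_comap] at h1
  have h2 := Submodule.finrank_pi_quotient_add (biDegree m m')
    (fun τ : T.InteriorEdge => edgeIdeal m m' r τ.1) fun τ => edgeIdeal_le τ.1
  have h3 := Submodule.finrank_pi_quotient_add (biDegree m m')
    (fun γ : T.InteriorVertex => vertexIdeal m m' r γ.1) fun γ => vertexIdeal_le γ.1
  have h4 := finrank_idealH₀_add (T := T) (m := m) (m' := m') (r := r)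
  unfold eulerChar
  change _ = Module.finrank ℝ (T.Q₂ m m') + _ + _ at h1
  change Module.finrank ℝ (T.Q₁ m m' r) + Module.finrank ℝ (T.idealChain₁ m m' r) = _ at h2
  change Module.finrank ℝ (T.Q₀ m m' r) + Module.finrank ℝ (T.idealChain₀ m m' r) = _ at h3
  omega

end TMesh

/-! ### The dimension formula and its stability -/

theorem mainTheorem1 (T : TMesh) (hT : T.IsSimplyConnected) (m m' : ℕ) (r : T.Smoothness) :
    Module.Finite ℝ (T.splineSpace m m' r) ∧
    Module.Finite ℝ (T.IdealH₀ m m' r) ∧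
    (Module.finrank ℝ (T.splineSpace m m' r) : ℤ) =
      T.eulerChar m m' r + Module.finrank ℝ (T.IdealH₀ m m' r) ∧
    T.eulerChar m m' r = T.combinatorialFormula m m' r ∧
    (Module.finrank ℝ (T.IdealH₀ m m' r) = 0 →
      (Module.finrank ℝ (T.splineSpace m m' r) : ℤ) = T.eulerChar m m' r ∧
      ∀ (T' : TMesh) (_ : T'.IsSimplyConnected) (r' : T'.Smoothness)
        (_ : TMesh.CombinatorialEquiv r r'),
        Module.finrank ℝ (T'.IdealH₀ m m' r') = 0 →
          Module.finrank ℝ (T'.splineSpace m m' r') =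
            Module.finrank ℝ (T.splineSpace m m' r)) := by
  have hfin := TMesh.finite_idealChain₀ (T := T) (m := m) (m' := m') (r := r)
  refine ⟨TMesh.finite_splineSpace, inferInstance, TMesh.finrank_splineSpace hT,
    TMesh.eulerChar_eq_combinatorialFormula m m' r, fun h0 => ?_⟩
  have h1 : (Module.finrank ℝ (T.splineSpace m m' r) : ℤ) = T.eulerChar m m' r := by
    rw [TMesh.finrank_splineSpace hT, h0, Nat.cast_zero, add_zero]
  refine ⟨h1, fun T' hT' r' e h0' => ?_⟩
  have h2 := TMesh.finrank_splineSpace (m := m) (m' := m') (r := r') hT'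
  rw [h0', TMesh.eulerChar_eq_combinatorialFormula, TMesh.combinatorialFormula_congr e,
    ← TMesh.eulerChar_eq_combinatorialFormula, ← h1, Nat.cast_zero, add_zero] at h2
  exact_mod_cast h2
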